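/- Let $\mathcal A$ be an arbitrary complex unital associative algebra and let $\mathcal A[[\lambda]]$ be the algebra of formal power series in a central parameter $\lambda$ with coefficients in $\mathcal A$. **The Drinfel'd associator.** For $A,B\in\mathcal A$ and $\delta,\epsilon\in\,]0,\tfrac14]$ let $c_{\delta,\epsilon}(s)=(1-s)\delta+s(1-\epsilon)$, $s\in[0,1]$, and let $W_{\delta,\epsilon}=W(1)\in\mathcal A[[\lambda]]$ be the parallel transport along $c_{\delta,\epsilon}$ for the Knizhnik--Zamolodchikov connection $\Gamma(B,A)=\left(\frac1x A+\frac1{x-1}B\right)\mathrm dx$ on $]0,1[$; here $W$ is the solution, in formal power series in $\lambda$ with coefficients in $C^\infty([0,1],\mathbb C)\otimes\mathcal A$, of $$\frac{\mathrm dW}{\mathrm ds}=\lambda\, c_{\delta,\epsilon}'(s)\left(\frac{1}{c_{\delta,\epsilon}(s)}A+\frac{1}{c_{\delta,\epsilon}(s)-1}B\right)W,\qquad W(0)=1.$$ Define $\Phi_{\delta,\epsilon}(A,B)$ by $$W_{\delta,\epsilon}=e^{\lambda\ln(\epsilon)B}\,\Phi_{\delta,\epsilon}(A,B)\,e^{-\lambda\ln(\delta)A}.$$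 Each coefficient of $\Phi_{\delta,\epsilon}(A,B)$ takes its values in a finite-dimensional subspace of $\mathcal A$ that does not depend on $(\delta,\epsilon)$, and the Drinfel'd associator is the limit $$\Phi(A,B)=\lim_{(\delta,\epsilon)\to(0,0)}\Phi_{\delta,\epsilon}(A,B)\in\mathcal A[[\lambda]],$$ taken coefficient by coefficient in $\lambda$ with respect to any norm on the complex vector space $\mathcal A$. This limit exists and is unique for all $A,B\in\mathcal A$. **Theorem (Pentagon Equation).** Let $A_{ij}\in\mathcal A$ ($1\le i\ne j\le 4$) satisfy the infinitesimal braid relations: $A_{ij}=A_{ji}$ for all $i\ne j$; $[A_{ij}+A_{ik},A_{jk}]=0$ for all pairwise distinct $i,j,k$; and $[A_{ij},A_{kl}]=0$ for all pairwise distinct $i,j,k,l$. Then in $\mathcal A[[\lambda]]$ $$\Phi(A_{12},A_{23}+A_{24})\,\Phi(A_{13}+A_{23},A_{34})=\Phi(A_{23},A_{34})\,\Phi(A_{12}+A_{13},A_{24}+A_{34})\,\Phi(A_{12},A_{23}).$$ -/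

import Mathlib

open scoped PowerSeries ContDiff

/-- The infinitesimal braid relations for a family `A i j`, `i ≠ j`, indexed by `n` letters.
The diagonal entries `A i i` play no role. -/
structure InfinitesimalBraidRelations {n : ℕ} {𝒜 : Type*} [Ring 𝒜]
    (A : Fin n → Fin n → 𝒜) : Prop where
  symm : ∀ i j, i ≠ j → A i j = A j i
  comm_three : ∀ i j k, i ≠ j → i ≠ k → j ≠ k → Commute (A i j + A i k) (A j k)
  comm_four : ∀ i j k l, i ≠ j → i ≠ k → i ≠ l → j ≠ k → j ≠ l → k ≠ l →
    Commute (A i j) (A k l)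

/-- The formal exponential `e^{λ a} = ∑ₙ λⁿ aⁿ / n!` in `𝒜[[λ]]`; the formal parameter `λ` is the
power series variable `PowerSeries.X`, which is central. -/
noncomputable def formalExp {𝒜 : Type*} [Ring 𝒜] [Algebra ℂ 𝒜] (a : 𝒜) : 𝒜⟦X⟧ :=
  PowerSeries.mk fun n => ((n.factorial : ℂ)⁻¹) • a ^ n

/-- `F` (on `[a, b]`) lies in the algebraic tensor product `C^∞([a, b], ℂ) ⊗ E`, i.e. it is a
finite sum of terms `f ⊗ v`, and its derivative `(d/ds ⊗ id) F` is equal to `F'` on `]a, b[`.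
No topology on `E` is involved, and `(d/ds ⊗ id) F` does not depend on how `F` is written. -/
def HasSmoothDeriv {E : Type*} [AddCommGroup E] [Module ℂ E] (a b : ℝ) (F F' : ℝ → E) : Prop :=
  ∃ (n : ℕ) (f : Fin n → ℝ → ℂ) (v : Fin n → E),
    (∀ i, ContDiffOn ℝ ∞ (f i) (Set.Icc a b)) ∧
    (∀ s ∈ Set.Icc a b, F s = ∑ i, f i s • v i) ∧
    (∀ s ∈ Set.Ioo a b, F' s = ∑ i, deriv (f i) s • v i)

/-- `W` is the fundamental solution on `[a, b]`, normalized at `α`, of the formal linear ODE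
`dW/ds = λ Y W`, `W(α) = 1`, in formal power series with coefficients in `C^∞([a, b], ℂ) ⊗ 𝒜`. -/
def IsFundamentalSolution {𝒜 : Type*} [Ring 𝒜] [Algebra ℂ 𝒜] (a b α : ℝ)
    (Y W : ℝ → 𝒜⟦X⟧) : Prop :=
  W α = 1 ∧ ∀ r : ℕ, HasSmoothDeriv a b (fun s => PowerSeries.coeff r (W s))
    (fun s => PowerSeries.coeff r (PowerSeries.X * Y s * W s))

/-- `T` is the parallel transport (the propagator `W₁₀`) along the path `c : [0, 1] → ℝ` with
respect to the formal connection `Γ(x) dx`. The pulled back vector field is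
`s ↦ c'(s) Γ(c(s))`. -/
def IsParallelTransport {𝒜 : Type*} [Ring 𝒜] [Algebra ℂ 𝒜] (Γ : ℝ → 𝒜⟦X⟧) (c : ℝ → ℝ)
    (T : 𝒜⟦X⟧) : Prop :=
  ∃ W : ℝ → 𝒜⟦X⟧,
    IsFundamentalSolution 0 1 0 (fun s => ((deriv c s : ℝ) : ℂ) • Γ (c s)) W ∧ T = W 1

/-- The coefficient of `dx` in the formal connection `Γ(B, A) = (A / x + B / (x - 1)) dx` on
`]0, 1[`. -/
noncomputable def kzConnection {𝒜 : Type*} [Ring 𝒜] [Algebra ℂ 𝒜] (B A : 𝒜) (x : ℝ) : 𝒜⟦X⟧ :=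
  PowerSeries.C (((1 / x : ℝ) : ℂ) • A + ((1 / (x - 1) : ℝ) : ℂ) • B)

/-- The affine path from `δ` to `1 - ε`. -/
def affinePath (δ ε : ℝ) (s : ℝ) : ℝ := (1 - s) * δ + s * (1 - ε)

/-- The parameter set `]0, 1/4] × ]0, 1/4]` of the pairs `(δ, ε)`. -/
def parameterSet : Set (ℝ × ℝ) := Set.Ioc (0 : ℝ) (1 / 4) ×ˢ Set.Ioc (0 : ℝ) (1 / 4)

/-- `F`, restricted to `J`, is an element of `(Fun(J, ℂ) ⊗ 𝒜)[[λ]]` (every coefficient takes its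
values in some finite-dimensional subspace), and `F(p) → ξ` for `p → p₀`, `p ∈ J`: coefficient by
coefficient, with respect to any norm on the complex vector space `𝒜`. On a finite-dimensional
subspace all norms are equivalent, so that the choice of the norm does not matter. -/
def HasFormalLimit {𝒜 : Type*} [Ring 𝒜] [Algebra ℂ 𝒜] {P : Type*} [TopologicalSpace P]
    (J : Set P) (p₀ : P) (F : P → 𝒜⟦X⟧) (ξ : 𝒜⟦X⟧) : Prop :=
  ∀ r : ℕ,
    (∃ V : Submodule ℂ 𝒜, FiniteDimensional ℂ V ∧ ∀ p ∈ J, PowerSeries.coeff r (F p) ∈ V) ∧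
    ∀ N : Seminorm ℂ 𝒜, (∀ x, N x = 0 → x = 0) →
      Filter.Tendsto (fun p => N (PowerSeries.coeff r (F p) - PowerSeries.coeff r ξ))
        (nhdsWithin p₀ J) (nhds 0)

/-- `Φ` is the Drinfel'd associator of `A, B`: for `0 < δ, ε ≤ 1/4` the parallel transport
`W_{δ,ε}` of `Γ(B, A)` along the affine path from `δ` to `1 - ε` is factorized as
`W_{δ,ε} = e^{λ ln(ε) B} Φ_{δ,ε} e^{-λ ln(δ) A}`, and `Φ_{δ,ε} → Φ` for `(δ, ε) → (0, 0)`. -/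
def IsDrinfeldAssociator {𝒜 : Type*} [Ring 𝒜] [Algebra ℂ 𝒜] (A B : 𝒜) (Φ : 𝒜⟦X⟧) : Prop :=
  ∃ W Φr : ℝ × ℝ → 𝒜⟦X⟧,
    (∀ δ ε : ℝ, (δ, ε) ∈ parameterSet →
      IsParallelTransport (kzConnection B A) (affinePath δ ε) (W (δ, ε)) ∧
      W (δ, ε) = formalExp (((Real.log ε : ℝ) : ℂ) • B) * Φr (δ, ε) *
        formalExp (-(((Real.log δ : ℝ) : ℂ) • A))) ∧
    HasFormalLimit parameterSet ((0 : ℝ), (0 : ℝ)) Φr Φ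

/-- The Drinfel'd associator `Φ(A, B) ∈ 𝒜[[λ]]` (with value `0` if there were none). -/
noncomputable def drinfeldAssociator {𝒜 : Type*} [Ring 𝒜] [Algebra ℂ 𝒜] (A B : 𝒜) : 𝒜⟦X⟧ :=
  open Classical in
  if h : ∃ Φ : 𝒜⟦X⟧, IsDrinfeldAssociator A B Φ then h.choose else 0

open Filter Topology Set

theorem norm_pow_le_norm_one_mul {R : Type*} [NormedRing R] (x : R) (n : ℕ) :
    ‖x ^ n‖ ≤ ‖(1 : R)‖ * ‖x‖ ^ n := by
  induction n with
  | zero => simp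
  | succ n ih =>
    calc ‖x ^ (n + 1)‖ ≤ ‖x ^ n‖ * ‖x‖ := by rw [pow_succ]; exact norm_mul_le _ _
      _ ≤ ‖(1 : R)‖ * ‖x‖ ^ n * ‖x‖ := by gcongr
      _ = _ := by ring

section RealPowers

variable {R : Type*} [NormedRing R] [NormedAlgebra ℝ R]

/-- The power `x ^ a = exp (log x · a)` of a positive real number with exponent in a Banach
algebra. -/
noncomputable def algPow (x : ℝ) (a : R) : R := NormedSpace.exp (Real.log x • a)

theorem Commute.algPow_left {a b : R} (h : Commute a b) (x : ℝ) : Commute (algPow x a) b :=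
  (h.smul_left _).exp_left

theorem Commute.algPow_right {a b : R} (h : Commute a b) (x : ℝ) : Commute a (algPow x b) :=
  (h.symm.algPow_left x).symm

theorem algPow_zero (x : ℝ) : algPow x (0 : R) = 1 := by
  simp [algPow]

theorem algPow_one (a : R) : algPow 1 a = 1 := by
  simp [algPow]

variable [CompleteSpace R]

theorem norm_exp_le_norm_one_mul (x : R) :
    ‖NormedSpace.exp x‖ ≤ ‖(1 : R)‖ * Real.exp ‖x‖ := by
  have h := NormedSpace.exp_series_hasSum_exp' (𝕂 := ℝ) x
  have h2 : HasSum (fun n : ℕ => ‖(1 : R)‖ * ((n.factorial : ℝ)⁻¹ • ‖x‖ ^ n))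
      (‖(1 : R)‖ * Real.exp ‖x‖) := by
    have := NormedSpace.exp_series_hasSum_exp' (𝕂 := ℝ) ‖x‖
    rw [← Real.exp_eq_exp_ℝ] at this
    exact this.mul_left _
  rw [← h.tsum_eq]
  refine tsum_of_norm_bounded h2 fun n => ?_
  rw [norm_smul, norm_inv, RCLike.norm_natCast, smul_eq_mul]
  have := norm_pow_le_norm_one_mul x n
  calc _ ≤ ((n.factorial : ℝ)⁻¹) * (‖(1 : R)‖ * ‖x‖ ^ n) := by gcongr
    _ = _ := by ring

theorem norm_algPow_le {x r : ℝ} (hx : 0 < x) (hx1 : x ≤ 1) {a : R} (ha : ‖a‖ ≤ r) :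
    ‖algPow x a‖ ≤ ‖(1 : R)‖ * x ^ (-r) := by
  refine (norm_exp_le_norm_one_mul _).trans ?_
  gcongr
  rw [norm_smul, Real.rpow_def_of_pos hx, Real.norm_eq_abs,
    abs_of_nonpos (Real.log_nonpos hx.le hx1)]
  have := Real.log_nonpos hx.le hx1
  exact Real.exp_le_exp.2 (by nlinarith)

theorem algPow_neg_mul (x : ℝ) (a : R) : algPow x (-a) * algPow x a = 1 := by
  let _ : NormedAlgebra ℚ R := NormedAlgebra.restrictScalars ℚ ℝ R
  rw [algPow, algPow, ← NormedSpace.exp_add_of_commute] <;> simp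

theorem algPow_mul_neg (x : ℝ) (a : R) : algPow x a * algPow x (-a) = 1 := by
  simpa using algPow_neg_mul x (-a)

theorem algPow_add {a b : R} (h : Commute a b) (x : ℝ) :
    algPow x (a + b) = algPow x a * algPow x b := by
  let _ : NormedAlgebra ℚ R := NormedAlgebra.restrictScalars ℚ ℝ R
  rw [algPow, smul_add, NormedSpace.exp_add_of_commute]
  · rfl
  · exact (h.smul_left _).smul_right _

theorem algPow_mul {x y : ℝ} (hx : 0 < x) (hy : 0 < y) (a : R) :
    algPow (x * y) a = algPow x a * algPow y a := by
  let _ : NormedAlgebra ℚ R := NormedAlgebra.restrictScalars ℚ ℝ R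
  rw [algPow, Real.log_mul hx.ne' hy.ne', add_smul, NormedSpace.exp_add_of_commute]
  · rfl
  · exact ((Commute.refl a).smul_left _).smul_right _

theorem hasDerivAt_algPow {x : ℝ} (hx : 0 < x) (a : R) :
    HasDerivAt (fun y => algPow y a) (x⁻¹ • (a * algPow x a)) x :=
  (hasDerivAt_exp_smul_const' (𝕂 := ℝ) a (Real.log x)).scomp x (Real.hasDerivAt_log hx.ne')

theorem continuousAt_algPow {x : ℝ} (hx : 0 < x) (a : R) :
    ContinuousAt (fun y => algPow y a) x :=
  (hasDerivAt_algPow hx a).continuousAt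

end RealPowers

section Growth

variable {E : Type*} [NormedAddCommGroup E] [NormedSpace ℝ E]

theorem norm_sub_le_of_norm_deriv_le_mul {f f' : ℝ → E} {M a b : ℝ} (hM : 0 < M) (hab : a ≤ b)
    (hf : ∀ x ∈ Icc a b, HasDerivAt f (f' x) x) (hb : ∀ x ∈ Icc a b, ‖f' x‖ ≤ M * ‖f x‖) :
    ‖f b - f a‖ ≤ (Real.exp (M * (b - a)) - 1) * ‖f a‖ := by
  have := norm_le_gronwallBound_of_norm_deriv_right_le (f := fun x => f x - f a) (f' := f')
    (δ := 0) (K := M) (ε := M * ‖f a‖) (a := a) (b := b)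
    (fun x hx => ((hf x hx).continuousAt.sub continuousAt_const).continuousWithinAt)
    (fun x hx => ((hf x (Ico_subset_Icc_self hx)).sub_const _).hasDerivWithinAt)
    (by simp) (fun x hx => by
      refine (hb x (Ico_subset_Icc_self hx)).trans ?_
      have : ‖f x‖ ≤ ‖f x - f a‖ + ‖f a‖ := norm_le_norm_sub_add _ _
      nlinarith) b (right_mem_Icc.2 hab)
  rw [gronwallBound_of_K_ne_0 hM.ne'] at this
  refine this.trans (le_of_eq ?_)
  field_simp
  ring

theorem norm_sub_le_of_norm_deriv_le_mul' {f f' : ℝ → E} {M a b : ℝ} (hM : 0 < M) (hab : a ≤ b)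
    (hf : ∀ x ∈ Icc a b, HasDerivAt f (f' x) x) (hb : ∀ x ∈ Icc a b, ‖f' x‖ ≤ M * ‖f x‖) :
    ‖f a - f b‖ ≤ (Real.exp (M * (b - a)) - 1) * ‖f b‖ := by
  have h : ∀ x ∈ Icc (-b) (-a), -x ∈ Icc a b := fun x hx => ⟨by linarith [hx.2], by linarith [hx.1]⟩
  have := norm_sub_le_of_norm_deriv_le_mul (f := fun x => f (-x)) (f' := fun x => -f' (-x)) hM
    (neg_le_neg hab) (fun x hx => by
      simpa [Function.comp_def] using (hf (-x) (h x hx)).scomp x (hasDerivAt_neg x)) (fun x hx => by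
      simpa using hb (-x) (h x hx))
  simpa [neg_add_eq_sub] using this

theorem norm_sub_le_of_norm_deriv_le_rpow {f f' : ℝ → E} {M a b : ℝ} (hM : 0 < M) (ha : 0 < a)
    (hab : a ≤ b) (hf : ∀ x ∈ Icc a b, HasDerivAt f (f' x) x)
    (hb : ∀ x ∈ Icc a b, ‖f' x‖ ≤ M * x ^ (-(1 / 2) : ℝ) * ‖f x‖) :
    ‖f b - f a‖ ≤ (Real.exp (2 * M * (√b - √a)) - 1) * ‖f a‖ ∧
      ‖f a - f b‖ ≤ (Real.exp (2 * M * (√b - √a)) - 1) * ‖f b‖ := by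
  have hmem : ∀ y ∈ Icc √a √b, 0 < y ∧ y ^ 2 ∈ Icc a b := fun y hy => by
    have h0 : 0 < y := (Real.sqrt_pos.2 ha).trans_le hy.1
    exact ⟨h0, (Real.sqrt_le_left h0.le).1 hy.1, (Real.le_sqrt h0.le (ha.trans_le hab).le).1 hy.2⟩
  have hd : ∀ y ∈ Icc √a √b,
      HasDerivAt (fun y => f (y ^ 2)) ((2 * y) • f' (y ^ 2)) y := fun y hy => by
    have h2 : HasDerivAt (fun y : ℝ => y ^ 2) (2 * y) y := by simpa using hasDerivAt_pow 2 y
    exact HasDerivAt.scomp (g₁ := f) y (hf _ (hmem y hy).2) h2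
  have hbd : ∀ y ∈ Icc √a √b, ‖(2 * y) • f' (y ^ 2)‖ ≤ 2 * M * ‖f (y ^ 2)‖ := fun y hy => by
    obtain ⟨h0, h1⟩ := hmem y hy
    have h2 : (y ^ 2) ^ (-(1 / 2) : ℝ) = y⁻¹ := by
      rw [Real.rpow_neg (by positivity), ← Real.sqrt_eq_rpow, Real.sqrt_sq h0.le]
    have h3 := hb _ h1
    rw [h2] at h3
    rw [norm_smul, Real.norm_of_nonneg (by positivity)]
    calc 2 * y * ‖f' (y ^ 2)‖ ≤ 2 * y * (M * y⁻¹ * ‖f (y ^ 2)‖) := by gcongr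
      _ = _ := by field_simp
  have hle := Real.sqrt_le_sqrt hab
  have h1 := norm_sub_le_of_norm_deriv_le_mul (by positivity) hle hd hbd
  have h2 := norm_sub_le_of_norm_deriv_le_mul' (by positivity) hle hd hbd
  simp only [Real.sq_sqrt ha.le, Real.sq_sqrt (ha.le.trans hab)] at h1 h2
  exact ⟨h1, h2⟩

/-- A function on `]0, c]²` whose logarithmic derivatives in the two directions are bounded by an
integrable singularity has a limit at the corner. -/
theorem exists_tendsto_corner [CompleteSpace E] {F Fs Ft : ℝ → ℝ → E} {c M : ℝ} (hc : 0 < c)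
    (hM : 0 < M)
    (hs : ∀ s ∈ Ioc 0 c, ∀ t ∈ Ioc 0 c, HasDerivAt (fun x => F x t) (Fs s t) s ∧
      ‖Fs s t‖ ≤ M * s ^ (-(1 / 2) : ℝ) * ‖F s t‖)
    (ht : ∀ s ∈ Ioc 0 c, ∀ t ∈ Ioc 0 c, HasDerivAt (fun x => F s x) (Ft s t) t ∧
      ‖Ft s t‖ ≤ M * t ^ (-(1 / 2) : ℝ) * ‖F s t‖) :
    ∃ L, Tendsto (fun p : ℝ × ℝ => F p.1 p.2) (𝓝[>] 0 ×ˢ 𝓝[>] 0) (𝓝 L) := by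
  have key : ∀ {f f' : ℝ → E}, (∀ s ∈ Ioc 0 c, HasDerivAt f (f' s) s ∧
      ‖f' s‖ ≤ M * s ^ (-(1 / 2) : ℝ) * ‖f s‖) → ∀ s ∈ Ioc 0 c, ∀ s' ∈ Ioc 0 c, s ≤ s' →
      ‖f s' - f s‖ ≤ (Real.exp (2 * M * (√s' - √s)) - 1) * ‖f s‖ ∧
      ‖f s - f s'‖ ≤ (Real.exp (2 * M * (√s' - √s)) - 1) * ‖f s'‖ := by
    intro f f' h s hs s' hs' hss
    have hI : ∀ x ∈ Icc s s', x ∈ Ioc 0 c := fun x hx => ⟨hs.1.trans_le hx.1, hx.2.trans hs'.2⟩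
    exact norm_sub_le_of_norm_deriv_le_rpow hM hs.1 hss (fun x hx => (h x (hI x hx)).1)
      (fun x hx => (h x (hI x hx)).2)
  have hcc : c ∈ Ioc 0 c := ⟨hc, le_rfl⟩
  have bound : ∀ {f f' : ℝ → E}, (∀ s ∈ Ioc 0 c, HasDerivAt f (f' s) s ∧
      ‖f' s‖ ≤ M * s ^ (-(1 / 2) : ℝ) * ‖f s‖) → ∀ s ∈ Ioc 0 c,
      ‖f s‖ ≤ Real.exp (2 * M * √c) * ‖f c‖ := by
    intro f f' h s hs
    have h1 := (key h s hs c hcc hs.2).2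
    have h2 : ‖f s‖ ≤ ‖f s - f c‖ + ‖f c‖ := norm_le_norm_sub_add _ _
    have h3 : Real.exp (2 * M * (√c - √s)) ≤ Real.exp (2 * M * √c) := by
      gcongr
      linarith [Real.sqrt_nonneg s]
    nlinarith [norm_nonneg (f c)]
  have close : ∀ {f f' : ℝ → E}, (∀ s ∈ Ioc 0 c, HasDerivAt f (f' s) s ∧
      ‖f' s‖ ≤ M * s ^ (-(1 / 2) : ℝ) * ‖f s‖) → ∀ K, (∀ s ∈ Ioc 0 c, ‖f s‖ ≤ K) →
      ∀ s ∈ Ioc 0 c, ∀ s' ∈ Ioc 0 c,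
      ‖f s - f s'‖ ≤ (Real.exp (2 * M * (√s + √s')) - 1) * K := by
    intro f f' h K hK s hs s' hs'
    have e1 : Real.exp (2 * M * (√s' - √s)) ≤ Real.exp (2 * M * (√s + √s')) := by
      gcongr
      linarith [Real.sqrt_nonneg s]
    have e2 : Real.exp (2 * M * (√s - √s')) ≤ Real.exp (2 * M * (√s + √s')) := by
      gcongr
      linarith [Real.sqrt_nonneg s']
    have e3 : 1 ≤ Real.exp (2 * M * (√s + √s')) := Real.one_le_exp (by positivity)
    rcases le_total s s' with hss | hss
    · refine (key h s hs s' hs' hss).2.trans ?_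
      gcongr
      exact hK s' hs'
    · refine (key h s' hs' s hs hss).1.trans ?_
      gcongr
      exact hK s' hs'
  set K := Real.exp (2 * M * √c) * (Real.exp (2 * M * √c) * ‖F c c‖)
  have hK : ∀ s ∈ Ioc 0 c, ∀ t ∈ Ioc 0 c, ‖F s t‖ ≤ K := fun s hs' t ht' =>
    (bound (f := fun x => F x t) (fun s hs' => hs s hs' t ht') s hs').trans
      (mul_le_mul_of_nonneg_left (bound (f := F c) (fun t ht' => ht c hcc t ht') t ht')
        (Real.exp_pos _).le)
  refine cauchy_map_iff_exists_tendsto.1 (cauchy_map_iff.2 ⟨inferInstance, ?_⟩)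
  rw [Metric.uniformity_eq_comap_nhds_zero, tendsto_comap_iff]
  have hI : ∀ᶠ x in 𝓝[>] (0 : ℝ), x ∈ Ioc 0 c := Ioc_mem_nhdsGT hc
  have hev := (hI.prod_mk hI).prod_mk (hI.prod_mk hI)
  have hsq : Tendsto (fun x : ℝ => √x) (𝓝[>] 0) (𝓝 0) := by
    have := Real.continuous_sqrt.tendsto 0
    rw [Real.sqrt_zero] at this
    exact this.mono_left nhdsWithin_le_nhds
  have hlim : Tendsto (fun p : (ℝ × ℝ) × (ℝ × ℝ) =>
      (Real.exp (2 * M * (√p.1.1 + √p.2.1)) - 1) * K +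
      (Real.exp (2 * M * (√p.1.2 + √p.2.2)) - 1) * K)
      ((𝓝[>] 0 ×ˢ 𝓝[>] 0) ×ˢ (𝓝[>] 0 ×ˢ 𝓝[>] 0)) (𝓝 0) := by
    have a11 := hsq.comp (tendsto_fst.comp (tendsto_fst (f := 𝓝[>] (0:ℝ) ×ˢ 𝓝[>] (0:ℝ))
      (g := 𝓝[>] (0:ℝ) ×ˢ 𝓝[>] (0:ℝ))))
    have a12 := hsq.comp (tendsto_snd.comp (tendsto_fst (f := 𝓝[>] (0:ℝ) ×ˢ 𝓝[>] (0:ℝ))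
      (g := 𝓝[>] (0:ℝ) ×ˢ 𝓝[>] (0:ℝ))))
    have a21 := hsq.comp (tendsto_fst.comp (tendsto_snd (f := 𝓝[>] (0:ℝ) ×ˢ 𝓝[>] (0:ℝ))
      (g := 𝓝[>] (0:ℝ) ×ˢ 𝓝[>] (0:ℝ))))
    have a22 := hsq.comp (tendsto_snd.comp (tendsto_snd (f := 𝓝[>] (0:ℝ) ×ˢ 𝓝[>] (0:ℝ))
      (g := 𝓝[>] (0:ℝ) ×ˢ 𝓝[>] (0:ℝ))))
    have e := Real.continuous_exp.tendsto (2 * M * (0 + 0))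
    have := (((e.comp ((a11.add a21).const_mul (2 * M))).sub_const 1).mul_const K).add
      (((e.comp ((a12.add a22).const_mul (2 * M))).sub_const 1).mul_const K)
    simpa [Function.comp_def] using this
  refine squeeze_zero' (Eventually.of_forall fun _ => dist_nonneg) ?_ hlim
  filter_upwards [hev] with p hp
  obtain ⟨⟨h11, h12⟩, h21, h22⟩ := hp
  rw [Function.comp_apply, dist_eq_norm]
  calc _ ≤ ‖F p.1.1 p.1.2 - F p.2.1 p.1.2‖ + ‖F p.2.1 p.1.2 - F p.2.1 p.2.2‖ :=
        norm_sub_le_norm_sub_add_norm_sub _ _ _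
    _ ≤ _ := add_le_add
        (close (f := fun x => F x p.1.2) (fun s hs' => hs s hs' _ h12) K
          (fun s hs' => hK s hs' _ h12) _ h11 _ h21)
        (close (f := F p.2.1) (fun t ht' => ht _ h21 t ht') K
          (fun t ht' => hK _ h21 t ht') _ h12 _ h22)

end Growth

section FlatSections

variable {R : Type*} [NormedRing R] [NormedAlgebra ℝ R]

/-- The relations under which the form `∑ i, c i • dlog (u i)` on the moduli cell is flat, the
`u i` being its five cyclically ordered boundary coordinates. -/
structure IsPentagonal {R : Type*} [Ring R] (c : Fin 5 → R) : Prop where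
  comm : ∀ i, Commute (c i) (c (i + 1))
  sum_eq_zero : ∑ i, (c i * c (i + 2) - c (i + 2) * c i) = 0

theorem IsPentagonal.shift {R : Type*} [Ring R] {c : Fin 5 → R} (hc : IsPentagonal c) :
    IsPentagonal fun i => c (i + 1) := by
  refine ⟨fun i => hc.comm (i + 1), ?_⟩
  rw [← hc.sum_eq_zero]
  exact Fintype.sum_equiv (Equiv.addRight 1) _ _ fun i => by
    simp only [Equiv.coe_addRight, add_right_comm i 2 1]

/-- The `ds`-component of `∑ i, c i • dlog (u i)` in the coordinates `s = u 0`, `t = u 1`, where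
`u 2 = (1 - s) / (1 - s t)`, `u 3 = 1 - s t` and `u 4 = (1 - t) / (1 - s t)`. -/
noncomputable def cellFormFst (c : Fin 5 → R) (s t : ℝ) : R :=
  s⁻¹ • c 0 - (1 - s)⁻¹ • c 2 + (t / (1 - s * t)) • (c 2 + c 4 - c 3)

/-- The `dt`-component of `∑ i, c i • dlog (u i)`. -/
noncomputable def cellFormSnd (c : Fin 5 → R) (s t : ℝ) : R :=
  t⁻¹ • c 1 - (1 - t)⁻¹ • c 4 + (s / (1 - s * t)) • (c 2 + c 4 - c 3)

/-- The total derivative of a section that is parallel for `∑ i, c i • dlog (u i)`. -/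
noncomputable def flatDeriv (c : Fin 5 → R) (p : ℝ × ℝ) (x : R) : ℝ × ℝ →L[ℝ] R :=
  (ContinuousLinearMap.fst ℝ ℝ ℝ).smulRight (cellFormFst c p.1 p.2 * x) +
    (ContinuousLinearMap.snd ℝ ℝ ℝ).smulRight (cellFormSnd c p.1 p.2 * x)

/-- `W` is an invertible parallel section of the connection `∑ i, c i • dlog (u i)` on the open
unit square. -/
structure IsFlatSection (c : Fin 5 → R) (W : ℝ × ℝ → R) : Prop where
  hasFDerivAt : ∀ p ∈ Ioo (0 : ℝ) 1 ×ˢ Ioo (0 : ℝ) 1, HasFDerivAt W (flatDeriv c p (W p)) p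
  isUnit : ∀ p ∈ Ioo (0 : ℝ) 1 ×ˢ Ioo (0 : ℝ) 1, IsUnit (W p)

variable {c : Fin 5 → R} {W : ℝ × ℝ → R}

theorem IsFlatSection.hasDerivAt_fst (hW : IsFlatSection c W) {s t : ℝ} (hs : s ∈ Ioo (0 : ℝ) 1)
    (ht : t ∈ Ioo (0 : ℝ) 1) :
    HasDerivAt (fun x => W (x, t)) (cellFormFst c s t * W (s, t)) s := by
  have h := HasFDerivAt.comp_hasDerivAt (f := fun x : ℝ => (x, t)) s
    (hW.hasFDerivAt (s, t) ⟨hs, ht⟩) ((hasDerivAt_id s).prodMk (hasDerivAt_const s t))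
  simpa [flatDeriv, Function.comp_def] using h

theorem IsFlatSection.hasDerivAt_snd (hW : IsFlatSection c W) {s t : ℝ} (hs : s ∈ Ioo (0 : ℝ) 1)
    (ht : t ∈ Ioo (0 : ℝ) 1) :
    HasDerivAt (fun x => W (s, x)) (cellFormSnd c s t * W (s, t)) t := by
  have h := HasFDerivAt.comp_hasDerivAt (f := fun x : ℝ => (s, x)) t
    (hW.hasFDerivAt (s, t) ⟨hs, ht⟩) ((hasDerivAt_const t s).prodMk (hasDerivAt_id t))
  simpa [flatDeriv, Function.comp_def] using h

variable [CompleteSpace R]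

theorem HasDerivAt.ringInverse {f : ℝ → R} {f' : R} {x : ℝ} (h : HasDerivAt f f' x)
    (hu : IsUnit (f x)) :
    HasDerivAt (fun y => Ring.inverse (f y))
      (-(Ring.inverse (f x) * f' * Ring.inverse (f x))) x := by
  obtain ⟨u, hu⟩ := hu
  have h1 := hasFDerivAt_ringInverse (𝕜 := ℝ) u
  rw [hu] at h1
  have := h1.comp_hasDerivAt x h
  simpa [Function.comp_def, ← hu] using this

theorem isUnit_algPow (x : ℝ) (a : R) : IsUnit (algPow x a) :=
  ⟨⟨algPow x a, algPow x (-a), algPow_mul_neg x a, algPow_neg_mul x a⟩, rfl⟩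

/-- The regular part of a connection with residues `a`, `d` along two boundary components, in the
gauge `x ^ (-a) * t ^ (-d)`. -/
noncomputable def cornerForm (a b d e : R) (s t : ℝ) : R :=
  algPow s (-a) * (-((1 - s)⁻¹ • b) + (t / (1 - s * t)) • (algPow t (-d) * e * algPow t d)) *
    algPow s a

theorem hasDerivAt_corner_gauge {a b d e : R} (had : Commute a d) (hbd : Commute b d) {f : ℝ → R}
    {s t : ℝ} (hs : 0 < s)
    (hf : HasDerivAt f ((s⁻¹ • a - (1 - s)⁻¹ • b + (t / (1 - s * t)) • e) * f s) s) :
    HasDerivAt (fun x => algPow x (-a) * algPow t (-d) * f x)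
      (cornerForm a b d e s t * (algPow s (-a) * algPow t (-d) * f s)) s := by
  have h := ((hasDerivAt_algPow hs (-a)).mul_const (algPow t (-d))).mul hf
  refine h.congr_deriv ?_
  have h1 : Commute a (algPow t (-d)) := had.neg_right.algPow_right t
  have h2 : Commute b (algPow t (-d)) := hbd.neg_right.algPow_right t
  have h3 : Commute a (algPow s (-a)) := (Commute.refl a).neg_right.algPow_right s
  have h4 : algPow s a * (algPow s (-a) * algPow t (-d) * f s) = algPow t (-d) * f s := by
    rw [mul_assoc, ← mul_assoc, algPow_mul_neg, one_mul]
  have h5 : algPow t (-d) * e * algPow t d * (algPow t (-d) * f s) = algPow t (-d) * e * f s := by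
    rw [mul_assoc _ _ (algPow t (-d) * f s), ← mul_assoc _ _ (f s), algPow_mul_neg, one_mul]
  rw [cornerForm, mul_assoc _ (algPow s a), h4, mul_assoc (algPow s (-a)) (-((1 - s)⁻¹ • b) + _),
    add_mul (-((1 - s)⁻¹ • b)), neg_mul ((1 - s)⁻¹ • b),
    smul_mul_assoc (t / (1 - s * t)) (_ * _ * _), h5]
  simp only [add_mul, sub_mul, smul_mul_assoc, mul_add, mul_sub, mul_smul_comm, neg_mul, mul_neg,
    smul_neg]
  have e1 : algPow s (-a) * algPow t (-d) * (a * f s) =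
      a * algPow s (-a) * algPow t (-d) * f s := by
    rw [h3.eq, ← mul_assoc, mul_assoc _ _ a, ← h1.eq, ← mul_assoc]
  have e2 : algPow s (-a) * algPow t (-d) * (b * f s) =
      algPow s (-a) * (b * (algPow t (-d) * f s)) := by
    rw [← mul_assoc b, h2.eq]
    simp only [mul_assoc]
  rw [e1, e2]
  simp only [mul_assoc]
  abel

theorem norm_cornerForm_le {a b d e : R} (ha : ‖a‖ ≤ 1 / 16) (hd : ‖d‖ ≤ 1 / 16) {s t : ℝ}
    (hs : s ∈ Ioc (0 : ℝ) (1 / 4)) (ht : t ∈ Ioc (0 : ℝ) (1 / 4)) :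
    ‖cornerForm a b d e s t‖ ≤
      (‖(1 : R)‖ ^ 2 * (2 * ‖b‖ + 2 * ‖(1 : R)‖ ^ 2 * ‖e‖) + 1) * s ^ (-(1 / 2) : ℝ) := by
  obtain ⟨hs0, hs1⟩ := hs
  obtain ⟨ht0, ht1⟩ := ht
  have pw : ∀ {x : ℝ} {y : R}, 0 < x → x ≤ 1 / 4 → ‖y‖ ≤ 1 / 16 →
      ‖algPow x y‖ ≤ ‖(1 : R)‖ * x ^ (-(1 / 16) : ℝ) := fun h0 h1 h =>
    norm_algPow_le h0 (by linarith) h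
  have hs2 : s ^ (-(1 / 16) : ℝ) * s ^ (-(1 / 16) : ℝ) ≤ s ^ (-(1 / 2) : ℝ) := by
    rw [← Real.rpow_add hs0]
    exact Real.rpow_le_rpow_of_exponent_ge hs0 (by linarith) (by norm_num)
  have ht2 : t * (t ^ (-(1 / 16) : ℝ) * t ^ (-(1 / 16) : ℝ)) ≤ 1 := by
    rw [← Real.rpow_add ht0, ← Real.rpow_one_add' ht0.le (by norm_num)]
    exact Real.rpow_le_one ht0.le (by linarith) (by norm_num)
  have hb : ‖(1 - s)⁻¹ • b‖ ≤ 2 * ‖b‖ := by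
    rw [norm_smul, Real.norm_of_nonneg (inv_nonneg.2 (by linarith))]
    gcongr
    rw [inv_le_comm₀ (by linarith) (by norm_num)]
    linarith
  have he : ‖(t / (1 - s * t)) • (algPow t (-d) * e * algPow t d)‖ ≤
      2 * ‖(1 : R)‖ ^ 2 * ‖e‖ := by
    have hst : s * t ≤ 1 / 2 := by nlinarith
    have h1 : t / (1 - s * t) ≤ 2 * t := by
      rw [div_le_iff₀ (by linarith)]
      nlinarith
    have h2 : 0 ≤ t / (1 - s * t) := div_nonneg ht0.le (by linarith)
    rw [norm_smul, Real.norm_of_nonneg h2]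
    calc _ ≤ 2 * t * (‖algPow t (-d)‖ * ‖e‖ * ‖algPow t d‖) := by
          gcongr
          exact norm_mul₃_le
      _ ≤ 2 * t * ((‖(1 : R)‖ * t ^ (-(1 / 16) : ℝ)) * ‖e‖ *
          (‖(1 : R)‖ * t ^ (-(1 / 16) : ℝ))) := by
          gcongr
          · exact pw ht0 ht1 (by rwa [norm_neg])
          · exact pw ht0 ht1 hd
      _ = 2 * ‖(1 : R)‖ ^ 2 * ‖e‖ * (t * (t ^ (-(1 / 16) : ℝ) * t ^ (-(1 / 16) : ℝ))) := by ring
      _ ≤ 2 * ‖(1 : R)‖ ^ 2 * ‖e‖ * 1 := by gcongr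
      _ = _ := mul_one _
  have hsum : ‖-((1 - s)⁻¹ • b) + (t / (1 - s * t)) • (algPow t (-d) * e * algPow t d)‖ ≤
      2 * ‖b‖ + 2 * ‖(1 : R)‖ ^ 2 * ‖e‖ :=
    (norm_add_le _ _).trans (add_le_add (by rwa [norm_neg]) he)
  calc _ ≤ ‖algPow s (-a)‖ * _ * ‖algPow s a‖ := norm_mul₃_le
    _ ≤ (‖(1 : R)‖ * s ^ (-(1 / 16) : ℝ)) * (2 * ‖b‖ + 2 * ‖(1 : R)‖ ^ 2 * ‖e‖) *
        (‖(1 : R)‖ * s ^ (-(1 / 16) : ℝ)) := by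
        gcongr
        · exact pw hs0 hs1 (by rwa [norm_neg])
        · exact pw hs0 hs1 ha
    _ = (‖(1 : R)‖ ^ 2 * (2 * ‖b‖ + 2 * ‖(1 : R)‖ ^ 2 * ‖e‖)) *
        (s ^ (-(1 / 16) : ℝ) * s ^ (-(1 / 16) : ℝ)) := by ring
    _ ≤ (‖(1 : R)‖ ^ 2 * (2 * ‖b‖ + 2 * ‖(1 : R)‖ ^ 2 * ‖e‖)) * s ^ (-(1 / 2) : ℝ) := by gcongr
    _ ≤ _ := by
        gcongr
        linarith

/-- A parallel section, regularized at a corner of the cell, has an invertible limit there. -/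
theorem IsFlatSection.exists_corner (hW : IsFlatSection c W) (hc : IsPentagonal c)
    (hsm : ∀ i, ‖c i‖ ≤ 1 / 16) :
    ∃ L, IsUnit L ∧ Tendsto (fun p : ℝ × ℝ => algPow p.1 (-c 0) * algPow p.2 (-c 1) * W p)
      (𝓝[>] 0 ×ˢ 𝓝[>] 0) (𝓝 L) := by
  have h01 : Commute (c 0) (c 1) := hc.comm 0
  have h12 : Commute (c 1) (c 2) := hc.comm 1
  have h40 : Commute (c 4) (c 0) := hc.comm 4
  set e := c 2 + c 4 - c 3
  set F : ℝ → ℝ → R := fun s t => algPow s (-c 0) * algPow t (-c 1) * W (s, t)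
  set H₁ := cornerForm (c 0) (c 2) (c 1) e
  set H₂ := fun s t => cornerForm (c 1) (c 4) (c 0) e t s
  have hI : ∀ {x : ℝ}, x ∈ Ioc (0 : ℝ) (1 / 4) → x ∈ Ioo (0 : ℝ) 1 := fun hx =>
    ⟨hx.1, by linarith [hx.2]⟩
  have hcomm : ∀ s t, algPow s (-c 0) * algPow t (-c 1) = algPow t (-c 1) * algPow s (-c 0) :=
    fun s t => ((h01.neg_left.neg_right).algPow_left s).algPow_right t
  have hs : ∀ s ∈ Ioc (0 : ℝ) (1 / 4), ∀ t ∈ Ioc (0 : ℝ) (1 / 4),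
      HasDerivAt (fun x => F x t) (H₁ s t * F s t) s := fun s hs t ht =>
    hasDerivAt_corner_gauge h01 h12.symm hs.1 (hW.hasDerivAt_fst (hI hs) (hI ht))
  have ht : ∀ s ∈ Ioc (0 : ℝ) (1 / 4), ∀ t ∈ Ioc (0 : ℝ) (1 / 4),
      HasDerivAt (fun x => F s x) (H₂ s t * F s t) t := fun s hs t ht => by
    have := hasDerivAt_corner_gauge (e := e) h01.symm h40 ht.1 (f := fun x => W (s, x)) (t := s)
      (by
        have h := hW.hasDerivAt_snd (hI hs) (hI ht)
        rwa [cellFormSnd, mul_comm s t] at h)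
    simpa only [F, hcomm] using this
  set M := max (‖(1 : R)‖ ^ 2 * (2 * ‖c 2‖ + 2 * ‖(1 : R)‖ ^ 2 * ‖e‖) + 1)
    (‖(1 : R)‖ ^ 2 * (2 * ‖c 4‖ + 2 * ‖(1 : R)‖ ^ 2 * ‖e‖) + 1)
  have hM : 0 < M := lt_max_of_lt_left (by positivity)
  have hb₁ : ∀ s ∈ Ioc (0 : ℝ) (1 / 4), ∀ t ∈ Ioc (0 : ℝ) (1 / 4),
      ‖H₁ s t‖ ≤ M * s ^ (-(1 / 2) : ℝ) := fun s hs t ht =>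
    (norm_cornerForm_le (hsm 0) (hsm 1) hs ht).trans (mul_le_mul_of_nonneg_right
      (le_max_left _ _) (Real.rpow_nonneg hs.1.le _))
  have hb₂ : ∀ s ∈ Ioc (0 : ℝ) (1 / 4), ∀ t ∈ Ioc (0 : ℝ) (1 / 4),
      ‖H₂ s t‖ ≤ M * t ^ (-(1 / 2) : ℝ) := fun s hs t ht =>
    (norm_cornerForm_le (hsm 1) (hsm 0) ht hs).trans (mul_le_mul_of_nonneg_right
      (le_max_right _ _) (Real.rpow_nonneg ht.1.le _))
  have hu : ∀ s ∈ Ioc (0 : ℝ) (1 / 4), ∀ t ∈ Ioc (0 : ℝ) (1 / 4), IsUnit (F s t) :=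
    fun s hs t ht => ((isUnit_algPow _ _).mul (isUnit_algPow _ _)).mul
      (hW.isUnit (s, t) ⟨hI hs, hI ht⟩)
  obtain ⟨L, hL⟩ := exists_tendsto_corner (F := F) (by norm_num) hM
    (fun s hs' t ht' => ⟨hs s hs' t ht', (norm_mul_le _ _).trans
      (mul_le_mul_of_nonneg_right (hb₁ s hs' t ht') (norm_nonneg _))⟩)
    (fun s hs' t ht' => ⟨ht s hs' t ht', (norm_mul_le _ _).trans
      (mul_le_mul_of_nonneg_right (hb₂ s hs' t ht') (norm_nonneg _))⟩)
  have hinv : ∀ {x y : R}, IsUnit x → Ring.inverse x * (y * x) * Ring.inverse x =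
      Ring.inverse x * y := fun {x y} hx => by
    rw [mul_assoc, mul_assoc, Ring.mul_inverse_cancel x hx, mul_one]
  have hnorm : ∀ {x y : R}, ‖-(x * y)‖ ≤ ‖y‖ * ‖x‖ := fun {x y} => by
    rw [norm_neg, mul_comm ‖y‖]
    exact norm_mul_le _ _
  obtain ⟨L', hL'⟩ := exists_tendsto_corner (F := fun s t => Ring.inverse (F s t))
    (by norm_num) hM
    (fun s hs' t ht' => ⟨(hs s hs' t ht').ringInverse (hu s hs' t ht'), by
      rw [hinv (hu s hs' t ht')]
      exact hnorm.trans (mul_le_mul_of_nonneg_right (hb₁ s hs' t ht') (norm_nonneg _))⟩)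
    (fun s hs' t ht' => ⟨(ht s hs' t ht').ringInverse (hu s hs' t ht'), by
      rw [hinv (hu s hs' t ht')]
      exact hnorm.trans (mul_le_mul_of_nonneg_right (hb₂ s hs' t ht') (norm_nonneg _))⟩)
  have hI : ∀ᶠ x in 𝓝[>] (0 : ℝ), x ∈ Ioc (0 : ℝ) (1 / 4) := Ioc_mem_nhdsGT (by norm_num)
  have hev := hI.prod_mk hI
  refine ⟨L, ⟨⟨L, L', ?_, ?_⟩, rfl⟩, hL⟩
  · refine tendsto_nhds_unique (hL.mul hL') (tendsto_const_nhds.congr' ?_)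
    filter_upwards [hev] with p hp
    exact (Ring.mul_inverse_cancel _ (hu _ hp.1 _ hp.2)).symm
  · refine tendsto_nhds_unique (hL'.mul hL) (tendsto_const_nhds.congr' ?_)
    filter_upwards [hev] with p hp
    exact (Ring.inverse_mul_cancel _ (hu _ hp.1 _ hp.2)).symm

end FlatSections

section Rotation

variable {R : Type*} [NormedRing R] [NormedAlgebra ℝ R]

/-- The rotation of the moduli cell: it maps the boundary coordinate `u i` to `u (i - 1)`. -/
noncomputable def cellRotation (p : ℝ × ℝ) : ℝ × ℝ := ((1 - p.2) / (1 - p.1 * p.2), p.1)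

theorem one_sub_mul_pos {p : ℝ × ℝ} (hp : p ∈ Ioo (0 : ℝ) 1 ×ˢ Ioo (0 : ℝ) 1) :
    0 < 1 - p.1 * p.2 := by
  obtain ⟨⟨h1, h2⟩, h3, h4⟩ := hp
  nlinarith

theorem cellRotation_mem {p : ℝ × ℝ} (hp : p ∈ Ioo (0 : ℝ) 1 ×ˢ Ioo (0 : ℝ) 1) :
    cellRotation p ∈ Ioo (0 : ℝ) 1 ×ˢ Ioo (0 : ℝ) 1 := by
  have h := one_sub_mul_pos hp
  obtain ⟨h1, h3, h4⟩ := hp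
  refine ⟨⟨div_pos (by linarith) h, (div_lt_one h).2 ?_⟩, h1⟩
  nlinarith [h1.2]

theorem cellRotation_iterate {p : ℝ × ℝ} (hp : p ∈ Ioo (0 : ℝ) 1 ×ˢ Ioo (0 : ℝ) 1) :
    cellRotation (cellRotation (cellRotation (cellRotation (cellRotation p)))) = p := by
  have h := (one_sub_mul_pos hp).ne'
  obtain ⟨s, t⟩ := p
  obtain ⟨⟨h1, h2⟩, h3, h4⟩ := hp
  simp only at h h1 h2 h3 h4
  have h' : 1 - t * s ≠ 0 := by rwa [mul_comm]
  have h5 : 1 - s ≠ 0 := by linarith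
  have h6 : 1 - t ≠ 0 := by linarith
  have e1 : 1 - (1 - t) / (1 - s * t) * s = (1 - s) / (1 - s * t) := by
    field_simp
    ring
  have r2 : cellRotation ((1 - t) / (1 - s * t), s) = (1 - s * t, (1 - t) / (1 - s * t)) := by
    simp only [cellRotation, e1]
    rw [div_div_cancel₀ h5]
  have e2 : 1 - (1 - s * t) * ((1 - t) / (1 - s * t)) = t := by
    field_simp
    ring
  have r3 : cellRotation (1 - s * t, (1 - t) / (1 - s * t)) =
      ((1 - s) / (1 - s * t), 1 - s * t) := by
    simp only [cellRotation, e2]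
    congr 1
    field_simp
    ring
  have e3 : 1 - (1 - s) / (1 - s * t) * (1 - s * t) = s := by
    field_simp
    ring
  have r4 : cellRotation ((1 - s) / (1 - s * t), 1 - s * t) = (t, (1 - s) / (1 - s * t)) := by
    simp only [cellRotation, e3]
    congr 1
    field_simp
    ring
  have e4 : 1 - t * ((1 - s) / (1 - s * t)) = (1 - t) / (1 - s * t) := by
    field_simp
    ring
  have r5 : cellRotation (t, (1 - s) / (1 - s * t)) = (s, t) := by
    simp only [cellRotation, e4]
    congr 1
    field_simp
    ring
  have r1 : cellRotation (s, t) = ((1 - t) / (1 - s * t), s) := rfl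
  rw [r1, r2, r3, r4, r5]

theorem hasFDerivAt_cellRotation {p : ℝ × ℝ} (hp : p ∈ Ioo (0 : ℝ) 1 ×ˢ Ioo (0 : ℝ) 1) :
    HasFDerivAt cellRotation
      ((((p.2 * (1 - p.2) / (1 - p.1 * p.2) ^ 2) • ContinuousLinearMap.fst ℝ ℝ ℝ -
        ((1 - p.1) / (1 - p.1 * p.2) ^ 2) • ContinuousLinearMap.snd ℝ ℝ ℝ)).prod
        (ContinuousLinearMap.fst ℝ ℝ ℝ)) p := by
  have h := (one_sub_mul_pos hp).ne'
  refine HasFDerivAt.prodMk ?_ hasFDerivAt_fst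
  have h1 : HasFDerivAt (fun p : ℝ × ℝ => 1 - p.2) (-ContinuousLinearMap.snd ℝ ℝ ℝ) p :=
    hasFDerivAt_snd.const_sub 1
  have h2 : HasFDerivAt (fun p : ℝ × ℝ => 1 - p.1 * p.2)
      (-(p.1 • ContinuousLinearMap.snd ℝ ℝ ℝ + p.2 • ContinuousLinearMap.fst ℝ ℝ ℝ)) p :=
    (hasFDerivAt_fst.mul hasFDerivAt_snd).const_sub 1
  refine (h1.mul ((hasDerivAt_inv h).comp_hasFDerivAt p h2)).congr_fderiv
    (ContinuousLinearMap.ext fun v => ?_)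
  simp
  field_simp
  ring

theorem IsFlatSection.rotate {c : Fin 5 → R} {W : ℝ × ℝ → R} (hW : IsFlatSection c W) :
    IsFlatSection (fun i => c (i + 1)) (W ∘ cellRotation) := by
  refine ⟨fun p hp => ?_, fun p hp => hW.isUnit _ (cellRotation_mem hp)⟩
  refine ((hW.hasFDerivAt _ (cellRotation_mem hp)).comp p
    (hasFDerivAt_cellRotation hp)).congr_fderiv ?_
  have h := (one_sub_mul_pos hp).ne'
  obtain ⟨s, t⟩ := p
  obtain ⟨⟨h1, h2⟩, h3, h4⟩ := hp
  simp only at h h1 h2 h3 h4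
  have h' : 1 - t * s ≠ 0 := by rwa [mul_comm]
  have h5 : 1 - s ≠ 0 := by linarith
  have h6 : 1 - t ≠ 0 := by linarith
  have e1 : 1 - (1 - t) / (1 - s * t) * s = (1 - s) / (1 - s * t) := by
    field_simp
    ring
  have e2 : 1 - (1 - t) / (1 - s * t) = t * (1 - s) / (1 - s * t) := by
    field_simp
    ring
  have k1 : (t * (1 - t) / (1 - s * t) ^ 2) • cellFormFst c ((1 - t) / (1 - s * t)) s +
      cellFormSnd c ((1 - t) / (1 - s * t)) s = cellFormFst (fun i => c (i + 1)) s t := by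
    simp only [cellFormFst, cellFormSnd, e1, e2, show (0 + 1 : Fin 5) = 1 from rfl,
      show (2 + 1 : Fin 5) = 3 from rfl, show (4 + 1 : Fin 5) = 0 from rfl,
      show (3 + 1 : Fin 5) = 4 from rfl]
    match_scalars <;> field_simp <;> ring
  have k2 : -(((1 - s) / (1 - s * t) ^ 2) • cellFormFst c ((1 - t) / (1 - s * t)) s) =
      cellFormSnd (fun i => c (i + 1)) s t := by
    simp only [cellFormFst, cellFormSnd, e1, e2, show (1 + 1 : Fin 5) = 2 from rfl,
      show (2 + 1 : Fin 5) = 3 from rfl, show (4 + 1 : Fin 5) = 0 from rfl,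
      show (3 + 1 : Fin 5) = 4 from rfl]
    match_scalars <;> field_simp <;> ring
  refine ContinuousLinearMap.ext fun v => ?_
  simp only [flatDeriv, ← k1, ← k2, cellRotation, ContinuousLinearMap.comp_apply,
    add_apply, ContinuousLinearMap.smulRight_apply,
    ContinuousLinearMap.prod_apply, sub_apply, ContinuousLinearMap.coe_fst',
    ContinuousLinearMap.coe_snd', smul_apply, smul_eq_mul, Function.comp_apply,
    add_mul, neg_mul, smul_mul_assoc]
  module

end Rotation

section KZ

variable {R : Type*} [NormedRing R] [NormedAlgebra ℝ R]

/-- `w` is an invertible solution on `]0, 1[` of `w' = (A / s + B / (s - 1)) w`. -/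
structure IsKZSolution (A B : R) (w : ℝ → R) : Prop where
  hasDerivAt : ∀ s ∈ Ioo (0 : ℝ) 1, HasDerivAt w ((s⁻¹ • A - (1 - s)⁻¹ • B) * w s) s
  isUnit : ∀ s ∈ Ioo (0 : ℝ) 1, IsUnit (w s)

/-- `φ` connects the two fundamental solutions of the KZ equation with the regular asymptotics
`s ^ A` at `0` and `(1 - s) ^ B` at `1`. -/
structure IsConnectionElement (A B φ : R) : Prop where
  isUnit : IsUnit φ
  exists_solution : ∃ w, IsKZSolution A B w ∧
    Tendsto (fun s => algPow s (-A) * w s) (𝓝[>] 0) (𝓝 1) ∧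
    Tendsto (fun s => algPow s (-B) * w (1 - s)) (𝓝[>] 0) (𝓝 φ)

variable {A B : R} {w : ℝ → R}

theorem one_sub_mem_Ioo {s : ℝ} (hs : s ∈ Ioo (0 : ℝ) 1) : 1 - s ∈ Ioo (0 : ℝ) 1 :=
  ⟨by linarith [hs.2], by linarith [hs.1]⟩

theorem IsKZSolution.reflect (hw : IsKZSolution A B w) :
    IsKZSolution B A fun s => w (1 - s) := by
  refine ⟨fun s hs => ?_, fun s hs => hw.isUnit _ (one_sub_mem_Ioo hs)⟩
  have := (hw.hasDerivAt _ (one_sub_mem_Ioo hs)).scomp s ((hasDerivAt_id s).const_sub 1)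
  refine this.congr_deriv ?_
  rw [neg_one_smul, ← neg_mul, sub_sub_cancel, neg_sub]

theorem IsKZSolution.mul_const (hw : IsKZSolution A B w) {x : R} (hx : IsUnit x) :
    IsKZSolution A B fun s => w s * x :=
  ⟨fun s hs => by simpa only [mul_assoc] using (hw.hasDerivAt s hs).mul_const x,
    fun s hs => (hw.isUnit s hs).mul hx⟩

theorem IsKZSolution.isFlatSection (hw : IsKZSolution A B w) :
    IsFlatSection ![A, 0, B, B, 0] fun p => w p.1 := by
  refine ⟨fun p hp => ?_, fun p hp => hw.isUnit _ hp.1⟩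
  refine ((hw.hasDerivAt _ hp.1).hasFDerivAt.comp p hasFDerivAt_fst).congr_fderiv ?_
  refine ContinuousLinearMap.ext fun v => ?_
  simp [flatDeriv, cellFormFst, cellFormSnd]

theorem isPentagonal_of_KZ {R : Type*} [NormedRing R] (A B : R) :
    IsPentagonal ![A, 0, B, B, 0] := by
  refine ⟨fun i => ?_, ?_⟩
  · fin_cases i <;> simp
  · simp only [Fin.sum_univ_five, show (0 + 2 : Fin 5) = 2 from rfl,
      show (1 + 2 : Fin 5) = 3 from rfl, show (2 + 2 : Fin 5) = 4 from rfl,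
      show (3 + 2 : Fin 5) = 0 from rfl, show (4 + 2 : Fin 5) = 1 from rfl]
    simp

theorem IsConnectionElement.symm {φ ψ : R} (h : IsConnectionElement A B φ) (h1 : ψ * φ = 1)
    (h2 : φ * ψ = 1) : IsConnectionElement B A ψ := by
  obtain ⟨w, hw, h0, h1'⟩ := h.exists_solution
  have hψ : IsUnit ψ := ⟨⟨ψ, φ, h1, h2⟩, rfl⟩
  refine ⟨hψ, fun s => w (1 - s) * ψ, hw.reflect.mul_const hψ, ?_, ?_⟩
  · simpa [mul_assoc, h2] using h1'.mul_const ψ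
  · simpa [mul_assoc] using h0.mul_const ψ

variable [CompleteSpace R]

theorem IsKZSolution.exists_tendsto (hw : IsKZSolution A B w) (hA : ‖A‖ ≤ 1 / 16)
    (hB : ‖B‖ ≤ 1 / 16) :
    ∃ L, IsUnit L ∧ Tendsto (fun s => algPow s (-A) * w s) (𝓝[>] 0) (𝓝 L) := by
  obtain ⟨L, hL, h⟩ := hw.isFlatSection.exists_corner (isPentagonal_of_KZ A B) (fun i => by
    fin_cases i
    exacts [hA, by simp, hB, hB, by simp])
  refine ⟨L, hL, ?_⟩
  have := h.comp (tendsto_id.prodMk tendsto_id : Tendsto (fun s : ℝ => (s, s)) (𝓝[>] 0) _)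
  simpa [Function.comp_def, algPow_zero] using this

theorem IsKZSolution.exists_isConnectionElement (hw : IsKZSolution A B w) (hA : ‖A‖ ≤ 1 / 16)
    (hB : ‖B‖ ≤ 1 / 16) : ∃ φ, IsConnectionElement A B φ := by
  obtain ⟨L, ⟨u, rfl⟩, h⟩ := hw.exists_tendsto hA hB
  obtain ⟨L', hL', h'⟩ := hw.reflect.exists_tendsto hB hA
  refine ⟨L' * ↑u⁻¹, hL'.mul u⁻¹.isUnit, fun s => w s * ↑u⁻¹, hw.mul_const u⁻¹.isUnit, ?_, ?_⟩
  · simpa [mul_assoc] using h.mul_const (↑u⁻¹ : R)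
  · simpa [mul_assoc] using h'.mul_const (↑u⁻¹ : R)

theorem tendsto_algPow_one_sub (a : R) :
    Tendsto (fun s : ℝ => algPow (1 - s) a) (𝓝[>] 0) (𝓝 1) := by
  have h1 : ContinuousAt (fun s : ℝ => algPow (1 - s) a) 0 :=
    ContinuousAt.comp (g := fun x : ℝ => algPow x a) (f := fun s : ℝ => 1 - s) (x := (0 : ℝ))
      (by simpa using continuousAt_algPow one_pos a) (by fun_prop)
  have h2 : Tendsto (fun s : ℝ => algPow (1 - s) a) (𝓝 0) (𝓝 1) := by
    simpa [ContinuousAt, algPow_one] using h1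
  exact h2.mono_left nhdsWithin_le_nhds

theorem IsConnectionElement.add {C D φ : R} (h : IsConnectionElement A B φ) (hAC : Commute A C)
    (hBC : Commute B C) (hAD : Commute A D) (hBD : Commute B D) (hCD : Commute C D) :
    IsConnectionElement (A + C) (B + D) φ := by
  obtain ⟨w, hw, h0, h1⟩ := h.exists_solution
  refine ⟨h.isUnit, fun s => algPow s C * algPow (1 - s) D * w s, ⟨fun s hs => ?_, fun s hs =>
    ((isUnit_algPow _ _).mul (isUnit_algPow _ _)).mul (hw.isUnit s hs)⟩, ?_, ?_⟩
  · have d1 := hasDerivAt_algPow hs.1 C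
    have d2 := (hasDerivAt_algPow (one_sub_mem_Ioo hs).1 D).scomp s ((hasDerivAt_id s).const_sub 1)
    refine ((d1.mul d2).mul (hw.hasDerivAt s hs)).congr_deriv ?_
    set X := algPow s C
    set Y := algPow (1 - s) D
    have c1 : Commute D X := (hCD.algPow_left s).symm
    have c2 : Commute A X := hAC.algPow_right s
    have c3 : Commute A Y := hAD.algPow_right _
    have c4 : Commute B X := hBC.algPow_right s
    have c5 : Commute B Y := hBD.algPow_right _
    simp only [Function.comp_apply, Pi.mul_apply, add_mul, sub_mul, mul_sub,
      smul_mul_assoc, mul_smul_comm, neg_smul, one_smul, neg_mul, mul_neg]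
    have e1 : X * (D * Y) * w s = D * (X * Y * w s) := by
      simp only [← mul_assoc, c1.eq]
    have e2 : X * Y * (A * w s) = A * (X * Y * w s) := by
      rw [← mul_assoc, ← mul_assoc, ((c2.mul_right c3).eq)]
    have e3 : X * Y * (B * w s) = B * (X * Y * w s) := by
      rw [← mul_assoc, ← mul_assoc, ((c4.mul_right c5).eq)]
    have e4 : C * X * Y * w s = C * (X * Y * w s) := by simp only [mul_assoc]
    rw [e1, e2, e3, e4]
    module
  · have := (tendsto_algPow_one_sub D).mul h0
    rw [one_mul] at this
    refine this.congr' ?_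
    filter_upwards [self_mem_nhdsWithin] with s hs
    rw [neg_add, algPow_add hAC.neg_left.neg_right]
    have c1 : Commute (algPow s (-A)) (algPow (1 - s) D) :=
      (hAD.neg_left.algPow_left s).algPow_right _
    calc _ = algPow s (-A) * (algPow s (-C) * algPow s C) * algPow (1 - s) D * w s := by
          rw [algPow_neg_mul, mul_one, c1.eq, mul_assoc]
      _ = _ := by simp only [mul_assoc]
  · have := (tendsto_algPow_one_sub C).mul h1
    rw [one_mul] at this
    refine this.congr' ?_
    filter_upwards [self_mem_nhdsWithin] with s hs
    rw [neg_add, algPow_add hBD.neg_left.neg_right,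
      sub_sub_cancel]
    have c1 : Commute (algPow s (-B)) (algPow (1 - s) C) :=
      (hBC.neg_left.algPow_left s).algPow_right _
    have c2 : Commute (algPow (1 - s) C) (algPow s D) := (hCD.algPow_left _).algPow_right _
    calc _ = algPow s (-B) * (algPow s (-D) * algPow s D) * algPow (1 - s) C * w (1 - s) := by
          rw [algPow_neg_mul, mul_one, c1.eq, mul_assoc]
      _ = algPow s (-B) * algPow s (-D) * (algPow s D * algPow (1 - s) C) * w (1 - s) := by
          simp only [mul_assoc]
      _ = _ := by
          rw [← c2.eq]
          simp only [mul_assoc]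

end KZ

section Edge

theorem exists_norm_le_of_tendsto {E : Type*} [NormedAddCommGroup E] {g : ℝ → E} {b : ℝ} {L : E}
    (hg : ContinuousOn g (Ioc 0 b)) (hL : Tendsto g (𝓝[>] 0) (𝓝 L)) :
    ∃ K, ∀ s ∈ Ioc 0 b, ‖g s‖ ≤ K := by
  have h1 : ∀ᶠ s in 𝓝[>] (0 : ℝ), ‖g s‖ ≤ ‖L‖ + 1 :=
    (hL.norm.eventually (eventually_lt_nhds (lt_add_one ‖L‖))).mono fun _ => le_of_lt
  obtain ⟨δ, hδ, h2⟩ := mem_nhdsGT_iff_exists_Ioo_subset.1 h1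
  have hδ0 : (0 : ℝ) < δ := hδ
  obtain ⟨K, hK⟩ := (isCompact_Icc (a := δ / 2) (b := b)).exists_bound_of_continuousOn
    (hg.mono fun s hs => ⟨by linarith [hs.1], hs.2⟩)
  refine ⟨max (‖L‖ + 1) K, fun s hs => ?_⟩
  rcases lt_or_ge s δ with h | h
  · exact (h2 ⟨hs.1, h⟩).trans (le_max_left _ _)
  · exact (hK s ⟨by linarith, hs.2⟩).trans (le_max_right _ _)

variable {R : Type*} [NormedRing R] [NormedAlgebra ℝ R] [CompleteSpace R]

variable {A B : R} {w : ℝ → R}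

theorem IsUnit.tendsto_ringInverse {R : Type*} [NormedRing R] [CompleteSpace R]
    {ι : Type*} {l : Filter ι} {f : ι → R} {x : R} (hx : IsUnit x)
    (hf : Tendsto f l (𝓝 x)) : Tendsto (fun i => Ring.inverse (f i)) l (𝓝 (Ring.inverse x)) := by
  obtain ⟨u, rfl⟩ := hx
  exact (NormedRing.inverse_continuousAt u).tendsto.comp hf

theorem ringInverse_mul_of_isUnit {R : Type*} [Ring R] {x y : R} (hx : IsUnit x) (hy : IsUnit y) :
    Ring.inverse (x * y) = Ring.inverse y * Ring.inverse x := by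
  obtain ⟨u, rfl⟩ := hx
  obtain ⟨v, rfl⟩ := hy
  rw [← Units.val_mul, Ring.inverse_unit, Ring.inverse_unit, Ring.inverse_unit, mul_inv_rev,
    Units.val_mul]

theorem ringInverse_algPow (x : ℝ) (a : R) : Ring.inverse (algPow x a) = algPow x (-a) := by
  have h := isUnit_algPow x a
  calc _ = Ring.inverse (algPow x a) * (algPow x a * algPow x (-a)) := by
        rw [algPow_mul_neg, mul_one]
    _ = _ := by rw [← mul_assoc, Ring.inverse_mul_cancel _ h, one_mul]

theorem IsKZSolution.exists_norm_le_near_zero (hw : IsKZSolution A B w) (hA : ‖A‖ ≤ 1 / 16)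
    (hB : ‖B‖ ≤ 1 / 16) :
    ∃ K, ∀ s ∈ Ioc (0 : ℝ) (1 / 2), ‖w s‖ ≤ K * s ^ (-(1 / 16) : ℝ) ∧
      ‖Ring.inverse (w s)‖ ≤ K * s ^ (-(1 / 16) : ℝ) := by
  obtain ⟨L, hL, h⟩ := hw.exists_tendsto hA hB
  have hI : ∀ s ∈ Ioc (0 : ℝ) (1 / 2), s ∈ Ioo (0 : ℝ) 1 := fun s hs => ⟨hs.1, by linarith [hs.2]⟩
  have hu : ∀ s ∈ Ioo (0 : ℝ) 1, IsUnit (algPow s (-A) * w s) := fun s hs =>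
    (isUnit_algPow _ _).mul (hw.isUnit s hs)
  have hcont : ∀ s ∈ Ioo (0 : ℝ) 1, ContinuousAt (fun s => algPow s (-A) * w s) s := fun s hs =>
    (continuousAt_algPow hs.1 _).mul (hw.hasDerivAt s hs).continuousAt
  obtain ⟨K₁, h₁⟩ := exists_norm_le_of_tendsto (b := 1 / 2)
    (fun s hs => (hcont s (hI s hs)).continuousWithinAt) h
  obtain ⟨K₂, h₂⟩ := exists_norm_le_of_tendsto (b := 1 / 2) (fun s hs => by
    exact ((hu s (hI s hs)).tendsto_ringInverse (hcont s (hI s hs)).tendsto).mono_left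
      nhdsWithin_le_nhds) (hL.tendsto_ringInverse h)
  have hK : ∀ {K s : ℝ} {x : R}, s ∈ Ioc (0 : ℝ) (1 / 2) → ‖x‖ ≤ K → K ≤ max K₁ K₂ →
      ‖x‖ * (‖(1 : R)‖ * s ^ (-(1 / 16) : ℝ)) ≤
        max K₁ K₂ * ‖(1 : R)‖ * s ^ (-(1 / 16) : ℝ) := fun {K s x} hs hx hK => by
    rw [mul_assoc]
    exact mul_le_mul_of_nonneg_right (hx.trans hK)
      (mul_nonneg (norm_nonneg _) (Real.rpow_nonneg hs.1.le _))
  refine ⟨max K₁ K₂ * ‖(1 : R)‖, fun s hs => ⟨?_, ?_⟩⟩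
  · have e : w s = algPow s A * (algPow s (-A) * w s) := by
      rw [← mul_assoc, algPow_mul_neg, one_mul]
    rw [e]
    refine (norm_mul_le _ _).trans (le_trans ?_ (hK hs (h₁ s hs) (le_max_left _ _)))
    rw [mul_comm]
    gcongr
    exact norm_algPow_le hs.1 (hI s hs).2.le hA
  · have e : Ring.inverse (w s) = Ring.inverse (algPow s (-A) * w s) * algPow s (-A) := by
      rw [ringInverse_mul_of_isUnit (isUnit_algPow _ _) (hw.isUnit s (hI s hs)),
        ringInverse_algPow, mul_assoc, neg_neg, algPow_mul_neg, mul_one]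
    rw [e]
    refine (norm_mul_le _ _).trans (le_trans ?_ (hK hs (h₂ s hs) (le_max_right _ _)))
    gcongr
    exact norm_algPow_le hs.1 (hI s hs).2.le (by rwa [norm_neg])

theorem IsKZSolution.exists_norm_le (hw : IsKZSolution A B w) (hA : ‖A‖ ≤ 1 / 16)
    (hB : ‖B‖ ≤ 1 / 16) :
    ∃ K, 0 ≤ K ∧ ∀ r ∈ Ioc (0 : ℝ) (1 / 2), ∀ s ∈ Icc r (1 - r),
      ‖w s‖ ≤ K * r ^ (-(1 / 16) : ℝ) ∧ ‖Ring.inverse (w s)‖ ≤ K * r ^ (-(1 / 16) : ℝ) := by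
  obtain ⟨K₁, h₁⟩ := hw.exists_norm_le_near_zero hA hB
  obtain ⟨K₂, h₂⟩ := hw.reflect.exists_norm_le_near_zero hB hA
  have key : ∀ {K r s x : ℝ}, 0 < r → r ≤ s → x ≤ K * s ^ (-(1 / 16) : ℝ) →
      K ≤ max 0 (max K₁ K₂) → x ≤ max 0 (max K₁ K₂) * r ^ (-(1 / 16) : ℝ) := by
    intro K r s x hr hrs hx hK
    refine hx.trans (mul_le_mul hK ?_ (Real.rpow_nonneg (hr.le.trans hrs) _) (le_max_left _ _))
    exact Real.rpow_le_rpow_of_nonpos hr hrs (by norm_num)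
  refine ⟨max 0 (max K₁ K₂), le_max_left _ _, fun r hr s hs => ?_⟩
  rcases le_total s (1 / 2) with h | h
  · have := h₁ s ⟨hr.1.trans_le hs.1, h⟩
    exact ⟨key hr.1 hs.1 this.1 ((le_max_left _ _).trans (le_max_right _ _)),
      key hr.1 hs.1 this.2 ((le_max_left _ _).trans (le_max_right _ _))⟩
  · have := h₂ (1 - s) ⟨by linarith [hs.2, hr.1], by linarith⟩
    simp only [sub_sub_cancel] at this
    have hs' : r ≤ 1 - s := by linarith [hs.2]
    exact ⟨key hr.1 hs' this.1 ((le_max_right _ _).trans (le_max_right _ _)),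
      key hr.1 hs' this.2 ((le_max_right _ _).trans (le_max_right _ _))⟩

theorem IsKZSolution.hasDerivAt_comparison {c : Fin 5 → R} {W : ℝ × ℝ → R}
    (hw : IsKZSolution (c 0) (c 2) w) (hW : IsFlatSection c W) (hc : IsPentagonal c) {s t : ℝ}
    (hs : s ∈ Ioo (0 : ℝ) 1) (ht : t ∈ Ioo (0 : ℝ) 1) :
    HasDerivAt (fun x => Ring.inverse (w x) * (algPow t (-c 1) * W (x, t)))
      (Ring.inverse (w s) * ((t / (1 - s * t)) • (algPow t (-c 1) * (c 2 + c 4 - c 3) *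
        algPow t (c 1))) * w s * (Ring.inverse (w s) * (algPow t (-c 1) * W (s, t)))) s := by
  have h := ((hw.hasDerivAt s hs).ringInverse (hw.isUnit s hs)).mul
    ((hW.hasDerivAt_fst hs ht).const_mul (algPow t (-c 1)))
  refine h.congr_deriv ?_
  set X := algPow t (-c 1)
  set Y := Ring.inverse (w s)
  set e := c 2 + c 4 - c 3
  have c0 : Commute (c 0) X := (hc.comm 0).neg_right.algPow_right t
  have c2 : Commute (c 2) X := (hc.comm 1).symm.neg_right.algPow_right t
  have hY : w s * Y = 1 := Ring.mul_inverse_cancel _ (hw.isUnit s hs)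
  have e1 : Y * ((s⁻¹ • c 0 - (1 - s)⁻¹ • c 2) * w s) * Y =
      Y * (s⁻¹ • c 0 - (1 - s)⁻¹ • c 2) := by
    rw [mul_assoc, mul_assoc, hY, mul_one]
  have e2 : ∀ z, Y * z * w s * (Y * (X * W (s, t))) = Y * z * (X * W (s, t)) := fun z => by
    rw [← mul_assoc, mul_assoc _ (w s), hY, mul_one]
  have e3 : algPow t (c 1) * (X * W (s, t)) = W (s, t) := by
    rw [← mul_assoc, algPow_mul_neg, one_mul]
  have e4 : X * (c 0 * W (s, t)) = c 0 * (X * W (s, t)) := by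
    rw [← mul_assoc, ← c0.eq, mul_assoc]
  have e5 : X * (c 2 * W (s, t)) = c 2 * (X * W (s, t)) := by
    rw [← mul_assoc, ← c2.eq, mul_assoc]
  have e6 : Y * ((t / (1 - s * t)) • (X * e * algPow t (c 1))) * (X * W (s, t)) =
      (t / (1 - s * t)) • (Y * (X * (e * W (s, t)))) := by
    rw [mul_smul_comm, smul_mul_assoc]
    simp only [mul_assoc, e3]
  have e7 : cellFormFst c s t = s⁻¹ • c 0 - (1 - s)⁻¹ • c 2 + (t / (1 - s * t)) • e := rfl
  rw [e1, e2, e6, e7]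
  clear_value e
  simp only [add_mul, sub_mul, mul_add, mul_sub, smul_mul_assoc, mul_smul_comm, neg_mul, mul_assoc,
    e4, e5]
  abel

/-- Along an edge of the cell, the limits of a parallel section at the two corners differ by the
connection element of the edge. -/
theorem IsFlatSection.corner_eq_mul {c : Fin 5 → R} {W : ℝ × ℝ → R} {φ L L' : R}
    (hW : IsFlatSection c W) (hc : IsPentagonal c) (hsm : ∀ i, ‖c i‖ ≤ 1 / 16)
    (hφ : IsConnectionElement (c 0) (c 2) φ)
    (hL : Tendsto (fun p : ℝ × ℝ => algPow p.1 (-c 0) * algPow p.2 (-c 1) * W p)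
      (𝓝[>] 0 ×ˢ 𝓝[>] 0) (𝓝 L))
    (hL' : Tendsto (fun p : ℝ × ℝ => algPow p.1 (-c 1) * algPow p.2 (-c 2) * W (cellRotation p))
      (𝓝[>] 0 ×ˢ 𝓝[>] 0) (𝓝 L')) : L' = φ * L := by
  obtain ⟨w, hw, hw0, hw1⟩ := hφ.exists_solution
  obtain ⟨K, hK0, hK⟩ := hw.exists_norm_le (hsm 0) (hsm 2)
  set e := c 2 + c 4 - c 3
  set u : ℝ → ℝ → R := fun t x => Ring.inverse (w x) * (algPow t (-c 1) * W (x, t))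
  set σ : ℝ → ℝ := fun t => (1 - t) / (1 - t * t)
  have hdiag : Tendsto (fun t : ℝ => (t, t)) (𝓝[>] 0) (𝓝[>] 0 ×ˢ 𝓝[>] 0) :=
    tendsto_id.prodMk tendsto_id
  have hI : ∀ᶠ t in 𝓝[>] (0 : ℝ), t ∈ Ioc (0 : ℝ) (1 / 4) := Ioc_mem_nhdsGT (by norm_num)
  have hσ : ∀ t ∈ Ioc (0 : ℝ) (1 / 4), σ t = 1 / (1 + t) := fun t ht => by
    have : 1 - t * t ≠ 0 := by nlinarith [ht.1, ht.2]
    have : 1 + t ≠ 0 := by linarith [ht.1]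
    rw [div_eq_div_iff (by assumption) (by assumption)]
    ring
  have hσ1 : ∀ t ∈ Ioc (0 : ℝ) (1 / 4), 1 - σ t = t * σ t := fun t ht => by
    have : 1 + t ≠ 0 := by linarith [ht.1]
    rw [hσ t ht]
    field_simp
    ring
  have hσ2 : ∀ t ∈ Ioc (0 : ℝ) (1 / 4), σ t ∈ Icc t (1 - t / 2) := fun t ht => by
    have h0 : 0 < 1 + t := by linarith [ht.1]
    rw [hσ t ht]
    exact ⟨(le_div_iff₀ h0).2 (by nlinarith [ht.1, ht.2]),
      (div_le_iff₀ h0).2 (by nlinarith [ht.1, ht.2])⟩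
  set C := 2 * ‖(1 : R)‖ ^ 2 * ‖e‖ * (2 * K) ^ 2 + 1
  have hC : 0 < C := by positivity
  have hdist : ∀ t ∈ Ioc (0 : ℝ) (1 / 4),
      ‖u t (σ t) - u t t‖ ≤ (Real.exp (C * t ^ (1 / 2 : ℝ)) - 1) * ‖u t t‖ := by
    intro t ht
    have ht0 := ht.1
    have ht' : t ∈ Ioo (0 : ℝ) 1 := ⟨ht0, by linarith [ht.2]⟩
    have hM : 0 < C * t ^ (1 / 2 : ℝ) := mul_pos hC (Real.rpow_pos_of_pos ht0 _)
    have hJ : ∀ s ∈ Icc t (σ t), s ∈ Ioo (0 : ℝ) 1 := fun s hs =>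
      ⟨ht0.trans_le hs.1, by linarith [hs.2, (hσ2 t ht).2]⟩
    refine (norm_sub_le_of_norm_deriv_le_mul hM (hσ2 t ht).1
      (fun s hs => hw.hasDerivAt_comparison hW hc (hJ s hs) ht') fun s hs => ?_).trans ?_
    · refine (norm_mul_le _ _).trans (mul_le_mul_of_nonneg_right ?_ (norm_nonneg _))
      obtain ⟨k1, k2⟩ := hK (t / 2) ⟨by linarith, by linarith [ht.2]⟩ s
        ⟨by linarith [hs.1], by linarith [hs.2, (hσ2 t ht).2]⟩
      have k3 : K * (t / 2) ^ (-(1 / 16) : ℝ) ≤ 2 * K * t ^ (-(1 / 16) : ℝ) := by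
        rw [Real.div_rpow ht0.le (by norm_num), div_eq_mul_inv,
          ← Real.rpow_neg (by norm_num : (0:ℝ) ≤ 2), neg_neg]
        have : (2 : ℝ) ^ (1 / 16 : ℝ) ≤ 2 := by
          simpa using Real.rpow_le_rpow_of_exponent_le (x := 2) (y := 1 / 16) (z := 1)
            (by norm_num) (by norm_num)
        calc _ ≤ K * (t ^ (-(1 / 16) : ℝ) * 2) := by gcongr
          _ = _ := by ring
      have hsJ := hJ s hs
      have hst : s * t ≤ 1 / 2 := by nlinarith [hsJ.1, hsJ.2, ht.2]
      have h1 : t / (1 - s * t) ≤ 2 * t := by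
        rw [div_le_iff₀ (by linarith)]
        nlinarith
      have h2 : 0 ≤ t / (1 - s * t) := div_nonneg ht0.le (by linarith)
      have p1 : ‖algPow t (-c 1)‖ ≤ ‖(1 : R)‖ * t ^ (-(1 / 16) : ℝ) :=
        norm_algPow_le ht0 ht'.2.le (by rw [norm_neg]; exact hsm 1)
      have p2 : ‖algPow t (c 1)‖ ≤ ‖(1 : R)‖ * t ^ (-(1 / 16) : ℝ) :=
        norm_algPow_le ht0 ht'.2.le (hsm 1)
      have p3 : t * (t ^ (-(1 / 16) : ℝ) * t ^ (-(1 / 16) : ℝ) * t ^ (-(1 / 16) : ℝ) *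
          t ^ (-(1 / 16) : ℝ)) ≤ t ^ (1 / 2 : ℝ) := by
        rw [← Real.rpow_add ht0, ← Real.rpow_add ht0, ← Real.rpow_add ht0,
          ← Real.rpow_one_add' ht0.le (by norm_num)]
        exact Real.rpow_le_rpow_of_exponent_ge ht0 ht'.2.le (by norm_num)
      have p4 : ‖(t / (1 - s * t)) • (algPow t (-c 1) * e * algPow t (c 1))‖ ≤
          2 * t * ((‖(1 : R)‖ * t ^ (-(1 / 16) : ℝ)) * ‖e‖ *
            (‖(1 : R)‖ * t ^ (-(1 / 16) : ℝ))) := by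
        rw [norm_smul, Real.norm_of_nonneg h2]
        gcongr
        exact norm_mul₃_le.trans (by gcongr)
      have hpow : 0 ≤ t ^ (-(1 / 16) : ℝ) := Real.rpow_nonneg ht0.le _
      calc _ ≤ ‖Ring.inverse (w s)‖ * _ * ‖w s‖ := norm_mul₃_le
        _ ≤ (2 * K * t ^ (-(1 / 16) : ℝ)) * (2 * t * ((‖(1 : R)‖ * t ^ (-(1 / 16) : ℝ)) * ‖e‖ *
            (‖(1 : R)‖ * t ^ (-(1 / 16) : ℝ)))) * (2 * K * t ^ (-(1 / 16) : ℝ)) := by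
          gcongr
          · exact k2.trans k3
          · exact k1.trans k3
        _ = (2 * ‖(1 : R)‖ ^ 2 * ‖e‖ * (2 * K) ^ 2) * (t * (t ^ (-(1 / 16) : ℝ) *
            t ^ (-(1 / 16) : ℝ) * t ^ (-(1 / 16) : ℝ) * t ^ (-(1 / 16) : ℝ))) := by ring
        _ ≤ (2 * ‖(1 : R)‖ ^ 2 * ‖e‖ * (2 * K) ^ 2) * t ^ (1 / 2 : ℝ) := by gcongr
        _ ≤ _ := by
          have := Real.rpow_nonneg ht0.le (1 / 2 : ℝ)
          simp only [C]
          nlinarith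
    · have h1 : σ t - t ≤ 1 := by linarith [(hσ2 t ht).2]
      exact mul_le_mul_of_nonneg_right (sub_le_sub_right
        (Real.exp_le_exp.2 (mul_le_of_le_one_right hM.le h1)) _) (norm_nonneg _)
  have hu0 : Tendsto (fun t => u t t) (𝓝[>] 0) (𝓝 L) := by
    have h := (isUnit_one.tendsto_ringInverse hw0).mul (hL.comp hdiag)
    rw [Ring.inverse_one, one_mul] at h
    refine h.congr' ?_
    filter_upwards [hI] with t ht
    have ht' : t ∈ Ioo (0 : ℝ) 1 := ⟨ht.1, by linarith [ht.2]⟩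
    rw [ringInverse_mul_of_isUnit (isUnit_algPow _ _) (hw.isUnit t ht'), ringInverse_algPow,
      neg_neg]
    simp only [u, Function.comp_apply]
    rw [mul_assoc, mul_assoc (algPow t (-c 0)), ← mul_assoc (algPow t (c 0)), algPow_mul_neg,
      one_mul]
  have hdiff : Tendsto (fun t => u t (σ t) - u t t) (𝓝[>] 0) (𝓝 0) := by
    have h1 : Tendsto (fun t : ℝ => t ^ (1 / 2 : ℝ)) (𝓝[>] 0) (𝓝 0) := by
      have := (Real.continuousAt_rpow_const 0 (1 / 2 : ℝ) (Or.inr (by norm_num))).tendsto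
      rw [Real.zero_rpow (by norm_num)] at this
      exact this.mono_left nhdsWithin_le_nhds
    have h2 := (((Real.continuous_exp.tendsto (C * 0)).comp (h1.const_mul C)).sub_const 1).mul
      hu0.norm
    rw [mul_zero, Real.exp_zero, sub_self, zero_mul] at h2
    refine squeeze_zero_norm' ?_ h2
    filter_upwards [hI] with t ht using hdist t ht
  have hu1 : Tendsto (fun t => u t (σ t)) (𝓝[>] 0) (𝓝 L) := by
    simpa using hdiff.add hu0
  have hσlim : Tendsto σ (𝓝[>] 0) (𝓝 1) := by
    have h : ContinuousAt σ 0 := ContinuousAt.div (by fun_prop) (by fun_prop) (by norm_num)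
    have h2 : Tendsto σ (𝓝 0) (𝓝 1) := by simpa [ContinuousAt, σ] using h
    exact h2.mono_left nhdsWithin_le_nhds
  have hw1' : Tendsto (fun t => algPow t (-c 2) * w (σ t)) (𝓝[>] 0) (𝓝 φ) := by
    have h1 : Tendsto (fun t => algPow (σ t) (c 2)) (𝓝[>] 0) (𝓝 1) := by
      have := (continuousAt_algPow one_pos (c 2)).tendsto.comp hσlim
      rwa [algPow_one] at this
    have h2 : Tendsto (fun t => 1 - σ t) (𝓝[>] 0) (𝓝[>] 0) := by
      refine tendsto_nhdsWithin_iff.2 ⟨by simpa using hσlim.const_sub 1, ?_⟩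
      filter_upwards [hI] with t ht
      have := (hσ2 t ht).2
      have := ht.1
      exact mem_Ioi.2 (by linarith)
    have h3 := h1.mul (hw1.comp h2)
    rw [one_mul] at h3
    refine h3.congr' ?_
    filter_upwards [hI] with t ht
    have hσp : 0 < σ t := ht.1.trans_le (hσ2 t ht).1
    simp only [Function.comp_apply, sub_sub_cancel]
    rw [hσ1 t ht, mul_comm t, algPow_mul hσp ht.1, ← mul_assoc, ← mul_assoc, algPow_mul_neg,
      one_mul]
  refine tendsto_nhds_unique (hL'.comp hdiag) ((hw1'.mul hu1).congr' ?_)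
  filter_upwards [hI] with t ht
  have hσJ : σ t ∈ Ioo (0 : ℝ) 1 :=
    ⟨ht.1.trans_le (hσ2 t ht).1, by linarith [(hσ2 t ht).2, ht.1]⟩
  have hcomm : Commute (algPow t (-c 1)) (algPow t (-c 2)) :=
    ((hc.comm 1).neg_left.neg_right.algPow_left t).algPow_right t
  simp only [Function.comp_apply, u]
  rw [mul_assoc (algPow t (-c 2)), ← mul_assoc (w (σ t)),
    Ring.mul_inverse_cancel _ (hw.isUnit _ hσJ), one_mul, ← mul_assoc, hcomm.eq]
  rfl

/-- The pentagon identity for connection elements, in its cyclically symmetric form. -/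
theorem IsFlatSection.pentagon {c : Fin 5 → R} {W : ℝ × ℝ → R} {φ : Fin 5 → R}
    (hW : IsFlatSection c W) (hc : IsPentagonal c) (hsm : ∀ i, ‖c i‖ ≤ 1 / 16)
    (hφ : ∀ i, IsConnectionElement (c i) (c (i + 2)) (φ i)) :
    φ 4 * φ 3 * φ 2 * φ 1 * φ 0 = 1 := by
  have step : ∀ {c : Fin 5 → R} {W : ℝ × ℝ → R} {φ L : R}, IsFlatSection c W → IsPentagonal c →
      (∀ i, ‖c i‖ ≤ 1 / 16) → IsConnectionElement (c 0) (c 2) φ →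
      Tendsto (fun p : ℝ × ℝ => algPow p.1 (-c 0) * algPow p.2 (-c 1) * W p)
        (𝓝[>] 0 ×ˢ 𝓝[>] 0) (𝓝 L) →
      Tendsto (fun p : ℝ × ℝ => algPow p.1 (-c 1) * algPow p.2 (-c 2) * (W ∘ cellRotation) p)
        (𝓝[>] 0 ×ˢ 𝓝[>] 0) (𝓝 (φ * L)) := by
    intro c W φ L hW hc hsm hφ hL
    obtain ⟨L', -, hL'⟩ := hW.rotate.exists_corner hc.shift fun i => hsm _
    exact hW.corner_eq_mul hc hsm hφ hL hL' ▸ hL'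
  obtain ⟨L, hL, h0⟩ := hW.exists_corner hc hsm
  have h1 := step hW hc hsm (hφ 0) h0
  have h2 := step hW.rotate hc.shift (fun i => hsm _) (hφ 1) h1
  have h3 := step hW.rotate.rotate hc.shift.shift (fun i => hsm _) (hφ 2) h2
  have h4 := step hW.rotate.rotate.rotate hc.shift.shift.shift (fun i => hsm _) (hφ 3) h3
  have h5 := step hW.rotate.rotate.rotate.rotate hc.shift.shift.shift.shift (fun i => hsm _)
    (hφ 4) h4
  have hI : ∀ᶠ x in 𝓝[>] (0 : ℝ), x ∈ Ioo (0 : ℝ) 1 := Ioo_mem_nhdsGT one_pos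
  have h := tendsto_nhds_unique h0 (h5.congr' (by
    filter_upwards [hI.prod_mk hI] with p hp
    simp only [Function.comp_apply, cellRotation_iterate (p := p) hp]
    rfl))
  simp only [← mul_assoc] at h
  exact hL.mul_right_cancel (h.symm.trans (one_mul L).symm)

end Edge

section FlatSectionExistence

variable {R : Type*} [NormedRing R] [NormedAlgebra ℝ R]

theorem isOpen_cell : IsOpen (Ioo (0 : ℝ) 1 ×ˢ Ioo (0 : ℝ) 1) := isOpen_Ioo.prod isOpen_Ioo

theorem convex_cell : Convex ℝ (Ioo (0 : ℝ) 1 ×ˢ Ioo (0 : ℝ) 1) :=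
  (convex_Ioo 0 1).prod (convex_Ioo 0 1)

theorem exists_hasFDerivAt_edge (a b e : R) {p : ℝ × ℝ}
    (hp : p ∈ Ioo (0 : ℝ) 1 ×ˢ Ioo (0 : ℝ) 1) :
    ∃ d : R, HasFDerivAt
      (fun p : ℝ × ℝ => p.1⁻¹ • a - (1 - p.1)⁻¹ • b + (p.2 / (1 - p.1 * p.2)) • e)
      ((ContinuousLinearMap.fst ℝ ℝ ℝ).smulRight d +
        (ContinuousLinearMap.snd ℝ ℝ ℝ).smulRight (((1 - p.1 * p.2) ^ 2)⁻¹ • e)) p := by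
  have h := (one_sub_mul_pos hp).ne'
  obtain ⟨⟨h1, h2⟩, h3, h4⟩ := hp
  have h2 : HasFDerivAt (fun p : ℝ × ℝ => 1 - p.1 * p.2)
      (-(p.1 • ContinuousLinearMap.snd ℝ ℝ ℝ + p.2 • ContinuousLinearMap.fst ℝ ℝ ℝ)) p :=
    (hasFDerivAt_fst.mul hasFDerivAt_snd).const_sub 1
  have d1 : HasFDerivAt (fun p : ℝ × ℝ => p.2 / (1 - p.1 * p.2)) _ p :=
    (hasFDerivAt_snd (𝕜 := ℝ) (p := p)).mul ((hasDerivAt_inv h).comp_hasFDerivAt p h2)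
  have d2 : HasFDerivAt (fun p : ℝ × ℝ => p.1⁻¹) _ p :=
    (hasDerivAt_inv h1.ne').comp_hasFDerivAt p (hasFDerivAt_fst (𝕜 := ℝ) (p := p))
  have d3 : HasFDerivAt (fun p : ℝ × ℝ => (1 - p.1)⁻¹) _ p :=
    (hasDerivAt_inv (by linarith : 1 - p.1 ≠ 0)).comp_hasFDerivAt p
      ((hasFDerivAt_fst (𝕜 := ℝ) (p := p)).const_sub 1)
  refine ⟨-(p.1 ^ 2)⁻¹ • a - ((1 - p.1) ^ 2)⁻¹ • b + (p.2 ^ 2 / (1 - p.1 * p.2) ^ 2) • e,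
    (((d2.smul_const a).sub (d3.smul_const b)).add (d1.smul_const e)).congr_fderiv
      (ContinuousLinearMap.ext fun v => ?_)⟩
  have h' : 1 - p.2 * p.1 ≠ 0 := by rwa [mul_comm]
  have h5 : 1 - p.1 ≠ 0 := by linarith
  simp
  match_scalars <;> field_simp
  ring

variable {c : Fin 5 → R}

theorem cellForm_commute (hc : IsPentagonal c) {s t : ℝ} (hs : s ≠ 0) (ht : t ≠ 0)
    (hs1 : 1 - s ≠ 0) (ht1 : 1 - t ≠ 0) (hst : 1 - s * t ≠ 0) :
    Commute (cellFormFst c s t) (cellFormSnd c s t) := by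
  have h01 : c 1 * c 0 = c 0 * c 1 := (hc.comm 0).symm
  have h12 : c 2 * c 1 = c 1 * c 2 := (hc.comm 1).symm
  have h23 : c 3 * c 2 = c 2 * c 3 := (hc.comm 2).symm
  have h34 : c 4 * c 3 = c 3 * c 4 := (hc.comm 3).symm
  have h40 : c 4 * c 0 = c 0 * c 4 := hc.comm 4
  have hsum := hc.sum_eq_zero
  simp only [Fin.sum_univ_five, show (0 + 2 : Fin 5) = 2 from rfl,
    show (1 + 2 : Fin 5) = 3 from rfl, show (2 + 2 : Fin 5) = 4 from rfl,
    show (3 + 2 : Fin 5) = 0 from rfl, show (4 + 2 : Fin 5) = 1 from rfl] at hsum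
  have h41 : c 4 * c 1 = c 1 * c 4 - (c 0 * c 2 - c 2 * c 0 + (c 1 * c 3 - c 3 * c 1) +
      (c 2 * c 4 - c 4 * c 2) + (c 3 * c 0 - c 0 * c 3)) :=
    eq_sub_of_add_eq' (sub_eq_zero.1 (by rw [← hsum]; abel))
  have h' : 1 - t * s ≠ 0 := by rwa [mul_comm]
  rw [commute_iff_eq, cellFormFst, cellFormSnd]
  simp only [add_mul, mul_add, sub_mul, mul_sub, smul_mul_assoc, mul_smul_comm, smul_smul,
    smul_add, smul_sub, h01, h12, h23, h34, h40, h41]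
  match_scalars <;> field_simp <;> ring

theorem flatDeriv_add (p : ℝ × ℝ) (x y : R) :
    flatDeriv c p (x + y) = flatDeriv c p x + flatDeriv c p y := by
  refine ContinuousLinearMap.ext fun v => ?_
  simp only [flatDeriv, add_apply, ContinuousLinearMap.smulRight_apply, mul_add, smul_add]
  abel

theorem exists_primitive [CompleteSpace R] (hc : IsPentagonal c) {U V : ℝ × ℝ → R}
    (hV : ∀ p ∈ Ioo (0 : ℝ) 1 ×ˢ Ioo (0 : ℝ) 1, HasFDerivAt V (flatDeriv c p (U p)) p) :
    ∃ V' : ℝ × ℝ → R, V' (1 / 2, 1 / 2) = 0 ∧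
      ∀ p ∈ Ioo (0 : ℝ) 1 ×ˢ Ioo (0 : ℝ) 1, HasFDerivAt V' (flatDeriv c p (V p)) p := by
  have hsmulR : ∀ (ℓ : ℝ × ℝ →L[ℝ] ℝ) {g : ℝ × ℝ → R} {g' : ℝ × ℝ →L[ℝ] R} {p : ℝ × ℝ},
      HasFDerivAt g g' p → HasFDerivAt (fun p => ℓ.smulRight (g p))
        ((ContinuousLinearMap.smulRightL ℝ (ℝ × ℝ) R ℓ).comp g') p := fun ℓ _ _ p hg =>
    (ContinuousLinearMap.smulRightL ℝ (ℝ × ℝ) R ℓ).hasFDerivAt.comp p hg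
  have key : ∀ p ∈ Ioo (0 : ℝ) 1 ×ˢ Ioo (0 : ℝ) 1, ∃ D : ℝ × ℝ →L[ℝ] ℝ × ℝ →L[ℝ] R,
      HasFDerivAt (fun p => flatDeriv c p (V p)) D p ∧ ∀ x y, D x y = D y x := by
    intro p hp
    obtain ⟨d₁, h₁⟩ := exists_hasFDerivAt_edge (c 0) (c 2) (c 2 + c 4 - c 3) hp
    have hp' : p.swap ∈ Ioo (0 : ℝ) 1 ×ˢ Ioo (0 : ℝ) 1 := ⟨hp.2, hp.1⟩
    obtain ⟨d₂, h₂⟩ := exists_hasFDerivAt_edge (c 1) (c 4) (c 2 + c 4 - c 3) hp'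
    have h₃ := h₂.comp p (hasFDerivAt_snd.prodMk hasFDerivAt_fst :
      HasFDerivAt (Prod.swap : ℝ × ℝ → ℝ × ℝ) _ p)
    have k₁ : HasFDerivAt (fun p => cellFormFst c p.1 p.2) _ p := h₁
    have k₂ : HasFDerivAt (fun p => cellFormSnd c p.1 p.2) _ p := h₃.congr_of_eventuallyEq
      (Eventually.of_forall fun q => by simp [cellFormSnd, mul_comm q.1])
    refine ⟨_, (hsmulR _ (k₁.mul' (hV p hp))).add (hsmulR _ (k₂.mul' (hV p hp))), fun x y => ?_⟩
    have hcomm : cellFormFst c p.1 p.2 * cellFormSnd c p.1 p.2 =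
        cellFormSnd c p.1 p.2 * cellFormFst c p.1 p.2 :=
      cellForm_commute hc hp.1.1.ne' hp.2.1.ne' (by linarith [hp.1.2]) (by linarith [hp.2.2])
        (one_sub_mul_pos hp).ne'
    simp [flatDeriv, ← mul_assoc, hcomm, mul_comm p.2]
    module
  obtain ⟨f, hf⟩ := convex_cell.exists_forall_hasFDerivAt_of_fderiv_symmetric isOpen_cell
    (show DifferentiableOn ℝ (fun p => flatDeriv c p (V p)) _ from
      fun p hp => (key p hp).choose_spec.1.differentiableAt.differentiableWithinAt)
    (fun p hp x y => by
      rw [(key p hp).choose_spec.1.fderiv]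
      exact (key p hp).choose_spec.2 x y)
  exact ⟨fun p => f p - f (1 / 2, 1 / 2), sub_self _, fun p hp => (hf p hp).sub_const _⟩

theorem flatDeriv_apply_mem {J : Submodule ℝ R} (hcJ : ∀ i, c i ∈ J) {p : ℝ × ℝ} {r : ℕ} {x : R}
    (hx : x ∈ J ^ r) (v : ℝ × ℝ) : flatDeriv c p x v ∈ J ^ (r + 1) := by
  have he : c 2 + c 4 - c 3 ∈ J := J.sub_mem (J.add_mem (hcJ 2) (hcJ 4)) (hcJ 3)
  have h1 : cellFormFst c p.1 p.2 ∈ J :=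
    J.add_mem (J.sub_mem (J.smul_mem _ (hcJ 0)) (J.smul_mem _ (hcJ 2))) (J.smul_mem _ he)
  have h2 : cellFormSnd c p.1 p.2 ∈ J :=
    J.add_mem (J.sub_mem (J.smul_mem _ (hcJ 1)) (J.smul_mem _ (hcJ 4))) (J.smul_mem _ he)
  rw [pow_succ']
  exact Submodule.add_mem _ (Submodule.smul_mem _ _ (Submodule.mul_mem_mul h1 hx))
    (Submodule.smul_mem _ _ (Submodule.mul_mem_mul h2 hx))

theorem mem_submodule_of_hasFDerivAt [FiniteDimensional ℝ R] {S : Submodule ℝ R}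
    {f : ℝ × ℝ → R} {f' : ℝ × ℝ → ℝ × ℝ →L[ℝ] R} {s : Set (ℝ × ℝ)} (hs : IsOpen s)
    (hs' : Convex ℝ s) (hf : ∀ p ∈ s, HasFDerivAt f (f' p) p) (hf' : ∀ p ∈ s, ∀ v, f' p v ∈ S)
    {p₀ p : ℝ × ℝ} (hp₀ : p₀ ∈ s) (h₀ : f p₀ ∈ S) (hp : p ∈ s) : f p ∈ S := by
  by_contra h
  obtain ⟨φ, hφ, hφS⟩ := S.exists_le_ker_of_notMem h
  set ψ := LinearMap.toContinuousLinearMap φ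
  have hd : ∀ p ∈ s, HasFDerivAt (fun p => ψ (f p)) (0 : ℝ × ℝ →L[ℝ] ℝ) p := fun p hp =>
    (ψ.hasFDerivAt.comp p (hf p hp)).congr_fderiv
      (ContinuousLinearMap.ext fun v => hφS (hf' p hp v))
  have := hs.is_const_of_fderiv_eq_zero hs'.isPreconnected
    (fun p hp => (hd p hp).differentiableAt.differentiableWithinAt)
    (fun p hp => (hd p hp).fderiv) hp hp₀
  exact hφ (this.trans (hφS h₀))

/-- If the residues are nilpotent, there is an invertible parallel section on the cell. -/
theorem exists_isFlatSection [FiniteDimensional ℝ R] [CompleteSpace R] (hc : IsPentagonal c)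
    {J : Submodule ℝ R} (hJ : J * J ≤ J) {n : ℕ} (hn : J ^ n = ⊥) (hcJ : ∀ i, c i ∈ J) :
    ∃ W, IsFlatSection c W := by
  have hpow : ∀ r, J ^ (r + 1) ≤ J := fun r => by
    induction r with
    | zero => simp
    | succ r ih =>
      rw [pow_succ]
      exact (mul_le_mul' ih le_rfl).trans hJ
  set Q := Ioo (0 : ℝ) 1 ×ˢ Ioo (0 : ℝ) 1
  have h0 : ((1 / 2, 1 / 2) : ℝ × ℝ) ∈ Q := by norm_num [Q]
  have key : ∀ r, ∃ W V U : ℝ × ℝ → R,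
      (∀ p ∈ Q, HasFDerivAt W (flatDeriv c p (W p - V p)) p) ∧
      (∀ p ∈ Q, HasFDerivAt V (flatDeriv c p (U p)) p) ∧
      (∀ p ∈ Q, V p ∈ J ^ r) ∧ ∀ p ∈ Q, W p - 1 ∈ J := by
    intro r
    induction r with
    | zero =>
      have hz : ∀ p, flatDeriv c p 0 = 0 := fun p => by
        refine ContinuousLinearMap.ext fun v => ?_
        simp [flatDeriv]
      refine ⟨fun _ => 1, fun _ => 1, fun _ => 0, fun p _ => ?_, fun p _ => ?_, fun p _ => ?_,
        fun p _ => ?_⟩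
      · simpa [hz] using hasFDerivAt_const (1 : R) p
      · simpa [hz] using hasFDerivAt_const (1 : R) p
      · rw [pow_zero]
        exact Submodule.one_le.1 le_rfl
      · simp
    | succ r ih =>
      obtain ⟨W, V, U, hW, hV, hVJ, hWJ⟩ := ih
      obtain ⟨V', hV0, hV'⟩ := exists_primitive hc hV
      have hmem : ∀ p ∈ Q, V' p ∈ J ^ (r + 1) := fun p hp =>
        mem_submodule_of_hasFDerivAt isOpen_cell convex_cell hV'
          (fun p hp v => flatDeriv_apply_mem hcJ (hVJ p hp) v) h0
          (by rw [hV0]; exact Submodule.zero_mem _) hp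
      refine ⟨fun p => W p + V' p, V', V, fun p hp => ?_, hV', hmem, fun p hp => ?_⟩
      · refine ((hW p hp).add (hV' p hp)).congr_fderiv ?_
        rw [← flatDeriv_add, sub_add_cancel, add_sub_cancel_right]
      · rw [add_sub_right_comm]
        exact J.add_mem (hWJ p hp) (hpow r (hmem p hp))
  obtain ⟨W, V, U, hW, -, hVJ, hWJ⟩ := key n
  refine ⟨W, fun p hp => ?_, fun p hp => ?_⟩
  · have hV : V p = 0 := by simpa [hn] using hVJ p hp
    simpa [hV] using hW p hp
  · have : IsNilpotent (W p - 1) := ⟨n, by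
      simpa [hn] using Submodule.pow_mem_pow J (hWJ p hp) n⟩
    simpa using this.isUnit_one_add

theorem exists_isConnectionElement [FiniteDimensional ℝ R] [CompleteSpace R] {A B : R}
    {J : Submodule ℝ R} (hJ : J * J ≤ J) {n : ℕ} (hn : J ^ n = ⊥) (hAJ : A ∈ J) (hBJ : B ∈ J)
    (hA : ‖A‖ ≤ 1 / 16) (hB : ‖B‖ ≤ 1 / 16) : ∃ φ, IsConnectionElement A B φ := by
  obtain ⟨W, hW⟩ := exists_isFlatSection (isPentagonal_of_KZ A B) hJ hn (fun i => by
    fin_cases i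
    exacts [hAJ, J.zero_mem, hBJ, hBJ, J.zero_mem])
  have h0 : (1 / 2 : ℝ) ∈ Ioo (0 : ℝ) 1 := by norm_num
  have hw : IsKZSolution A B fun s => W (s, 1 / 2) :=
    ⟨fun s hs => (hW.hasDerivAt_fst hs h0).congr_deriv (by simp [cellFormFst]),
      fun s hs => hW.isUnit _ ⟨hs, h0⟩⟩
  exact hw.exists_isConnectionElement hA hB

end FlatSectionExistence

section TruncatedModels

variable {𝒜 : Type*} [Ring 𝒜] [Algebra ℂ 𝒜]

theorem coeff_complex_smul (k : ℕ) (z : ℂ) (F : 𝒜⟦X⟧) :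
    PowerSeries.coeff k (z • F) = z • PowerSeries.coeff k F := rfl

theorem coeff_X_mul_C_mul {𝒜 : Type*} [Ring 𝒜] (k : ℕ) (a : 𝒜) (F : 𝒜⟦X⟧) :
    PowerSeries.coeff k (PowerSeries.X * PowerSeries.C a * F) =
      if k = 0 then 0 else a * PowerSeries.coeff (k - 1) F := by
  cases k with
  | zero => simp [mul_assoc]
  | succ k => simp [mul_assoc, PowerSeries.coeff_succ_X_mul]

/-- A finite-dimensional space of formal power series of degree at most `N` over `𝒜`, containing
the unit. -/
structure TruncatedModel (𝒜 : Type*) [Ring 𝒜] [Algebra ℂ 𝒜] (N : ℕ) where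
  dim : ℕ
  toSeries : (Fin dim → ℂ) →ₗ[ℂ] 𝒜⟦X⟧
  injective : Function.Injective toSeries
  coeff_eq_zero : ∀ v k, N < k → PowerSeries.coeff k (toSeries v) = 0
  unit : Fin dim → ℂ
  toSeries_unit : toSeries unit = 1

namespace TruncatedModel

variable {N : ℕ} (M : TruncatedModel 𝒜 N)

/-- The Banach algebra of operators on a truncated model. -/
abbrev Op := (Fin M.dim → ℂ) →L[ℂ] (Fin M.dim → ℂ)

/-- The operator `f` is left multiplication by `F` up to degree `N`. -/
def Represents (f : M.Op) (F : 𝒜⟦X⟧) : Prop :=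
  ∀ v, ∀ k ≤ N, PowerSeries.coeff k (M.toSeries (f v)) = PowerSeries.coeff k (F * M.toSeries v)

noncomputable instance : Module ℝ M.Op :=
  (inferInstance : NormedAlgebra ℝ M.Op).toAlgebra.toModule

variable {M}

theorem Represents.coeff_eq {f : M.Op} {F : 𝒜⟦X⟧} (h : M.Represents f F) {k : ℕ} (hk : k ≤ N) :
    PowerSeries.coeff k F = PowerSeries.coeff k (M.toSeries (f M.unit)) := by
  rw [h M.unit k hk, M.toSeries_unit, mul_one]

theorem Represents.mul {f g : M.Op} {F G : 𝒜⟦X⟧} (hf : M.Represents f F)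
    (hg : M.Represents g G) : M.Represents (f * g) (F * G) := by
  intro v k hk
  rw [mul_apply_eq_comp, hf _ k hk, mul_assoc, PowerSeries.coeff_mul,
    PowerSeries.coeff_mul]
  refine Finset.sum_congr rfl fun p hp => ?_
  have := Finset.HasAntidiagonal.mem_antidiagonal.1 hp
  rw [hg v p.2 (by omega)]

theorem Represents.one : M.Represents 1 1 := fun v k _ => by simp

theorem Represents.pow {f : M.Op} {F : 𝒜⟦X⟧} (hf : M.Represents f F) (n : ℕ) :
    M.Represents (f ^ n) (F ^ n) := by
  induction n with
  | zero => simpa using Represents.one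
  | succ n ih => simpa only [pow_succ] using ih.mul hf

theorem Represents.add {f g : M.Op} {F G : 𝒜⟦X⟧} (hf : M.Represents f F)
    (hg : M.Represents g G) : M.Represents (f + g) (F + G) := fun v k hk => by
  simp [add_mul, hf v k hk, hg v k hk]

theorem Represents.smul {f : M.Op} {F : 𝒜⟦X⟧} (hf : M.Represents f F) (r : ℝ) :
    M.Represents (r • f) ((r : ℂ) • F) := fun v k hk => by
  have : (r • f) v = (r : ℂ) • f v := rfl
  rw [this, map_smul, coeff_complex_smul, hf v k hk, smul_mul_assoc, coeff_complex_smul]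

theorem X_mul_C_add {𝒜 : Type*} [Ring 𝒜] (a b : 𝒜) :
    (PowerSeries.X * PowerSeries.C (a + b) : 𝒜⟦X⟧) =
      PowerSeries.X * PowerSeries.C a + PowerSeries.X * PowerSeries.C b := by
  rw [map_add, mul_add]

theorem X_mul_C_smul (z : ℂ) (a : 𝒜) : (PowerSeries.X * PowerSeries.C (z • a) : 𝒜⟦X⟧) =
    z • (PowerSeries.X * PowerSeries.C a) := by
  have : (PowerSeries.C (z • a) : 𝒜⟦X⟧) = z • PowerSeries.C a := by
    ext k
    rw [coeff_complex_smul, PowerSeries.coeff_C, PowerSeries.coeff_C]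
    split_ifs <;> simp
  rw [this, mul_smul_comm]

theorem Represents.add_X {f g : M.Op} {a b : 𝒜}
    (hf : M.Represents f (PowerSeries.X * PowerSeries.C a))
    (hg : M.Represents g (PowerSeries.X * PowerSeries.C b)) :
    M.Represents (f + g) (PowerSeries.X * PowerSeries.C (a + b)) := by
  rw [X_mul_C_add]
  exact hf.add hg

theorem Represents.smul_X {f : M.Op} {a : 𝒜}
    (hf : M.Represents f (PowerSeries.X * PowerSeries.C a)) (r : ℝ) :
    M.Represents (r • f) (PowerSeries.X * PowerSeries.C ((r : ℂ) • a)) := by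
  rw [X_mul_C_smul]
  exact hf.smul r

theorem Represents.neg_X {f : M.Op} {a : 𝒜}
    (hf : M.Represents f (PowerSeries.X * PowerSeries.C a)) :
    M.Represents (-f) (PowerSeries.X * PowerSeries.C (-a)) := by
  have h := hf.smul_X (-1)
  have e : (-1 : ℝ) • f = -f := neg_one_smul ℝ f
  rwa [e, Complex.ofReal_neg, Complex.ofReal_one, neg_one_smul] at h

variable (M) in
/-- The linear functional `v ↦ ψ (coeff k v)` on a truncated model. -/
noncomputable def coord (ψ : Module.Dual ℂ 𝒜) (k : ℕ) : (Fin M.dim → ℂ) →L[ℂ] ℂ :=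
  LinearMap.toContinuousLinearMap
    { toFun := fun v => ψ (PowerSeries.coeff k (M.toSeries v))
      map_add' := fun v w => by simp
      map_smul' := fun z v => by simp }

theorem coord_apply (ψ : Module.Dual ℂ 𝒜) (k : ℕ) (v : Fin M.dim → ℂ) :
    M.coord ψ k v = ψ (PowerSeries.coeff k (M.toSeries v)) := rfl

theorem eq_of_forall_dual {x y : 𝒜} (h : ∀ ψ : Module.Dual ℂ 𝒜, ψ x = ψ y) : x = y :=
  sub_eq_zero.1 ((Module.forall_dual_apply_eq_zero_iff ℂ (x - y)).1 fun ψ => by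
    rw [map_sub, h ψ, sub_self])

theorem coeff_X_mul_C_pow_mul {𝒜 : Type*} [Ring 𝒜] (k n : ℕ) (a : 𝒜) (F : 𝒜⟦X⟧) :
    PowerSeries.coeff k ((PowerSeries.X * PowerSeries.C a) ^ n * F) =
      if n ≤ k then a ^ n * PowerSeries.coeff (k - n) F else 0 := by
  induction n generalizing k with
  | zero => simp
  | succ n ih =>
    rw [pow_succ', mul_assoc, coeff_X_mul_C_mul]
    cases k with
    | zero => simp
    | succ k =>
      rw [if_neg (Nat.succ_ne_zero k), Nat.add_sub_cancel, ih, Nat.add_sub_add_right]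
      simp [pow_succ', mul_assoc]

theorem Represents.exp {f : M.Op} {a : 𝒜}
    (hf : M.Represents f (PowerSeries.X * PowerSeries.C a)) :
    M.Represents (NormedSpace.exp f) (formalExp a) := by
  intro v k hk
  refine eq_of_forall_dual fun ψ => ?_
  have h1 := (NormedSpace.exp_series_hasSum_exp' (𝕂 := ℂ) f)
  have h2 := (M.coord ψ k).hasSum ((ContinuousLinearMap.apply ℂ _ v).hasSum h1)
  have h3 : ∀ n : ℕ, M.coord ψ k (ContinuousLinearMap.apply ℂ (Fin M.dim → ℂ) v
      ((n.factorial : ℂ)⁻¹ • f ^ n)) = if n ≤ k then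
        ψ (((n.factorial : ℂ)⁻¹ • a ^ n) * PowerSeries.coeff (k - n) (M.toSeries v)) else 0 := by
    intro n
    have h4 : ContinuousLinearMap.apply ℂ (Fin M.dim → ℂ) v ((n.factorial : ℂ)⁻¹ • f ^ n) =
      (n.factorial : ℂ)⁻¹ • (f ^ n) v := rfl
    rw [h4, map_smul, coord_apply, hf.pow n v k hk, coeff_X_mul_C_pow_mul]
    split_ifs <;> simp
  simp only [h3] at h2
  have h5 := hasSum_sum_of_ne_finset_zero (L := .unconditional ℕ) (s := Finset.range (k + 1))
    (f := fun n => if n ≤ k then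
      ψ (((n.factorial : ℂ)⁻¹ • a ^ n) * PowerSeries.coeff (k - n) (M.toSeries v)) else 0)
    (fun n hn => if_neg (by simpa using hn))
  refine (h2.unique h5).trans ?_
  rw [PowerSeries.coeff_mul, map_sum, Finset.Nat.sum_antidiagonal_eq_sum_range_succ_mk]
  refine Finset.sum_congr rfl fun n hn => ?_
  rw [if_pos (Nat.lt_succ_iff.1 (Finset.mem_range.1 hn)), formalExp, PowerSeries.coeff_mk]

theorem Represents.algPow {f : M.Op} {a : 𝒜}
    (hf : M.Represents f (PowerSeries.X * PowerSeries.C a)) (x : ℝ) :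
    M.Represents (algPow x f) (formalExp (((Real.log x : ℝ) : ℂ) • a)) :=
  (hf.smul_X (Real.log x)).exp

variable (M) in
/-- The operators that raise the degree of vanishing by at least `r`. -/
def raising (r : ℕ) : Submodule ℝ M.Op where
  carrier := {f | ∀ v k, (∀ j < k, PowerSeries.coeff j (M.toSeries v) = 0) →
    ∀ j < k + r, PowerSeries.coeff j (M.toSeries (f v)) = 0}
  add_mem' hf hg v k hv j hj := by simp [hf v k hv j hj, hg v k hv j hj]
  zero_mem' v k hv j hj := by simp
  smul_mem' r f hf v k hv j hj := by
    have : (r • f) v = (r : ℂ) • f v := rfl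
    rw [this, map_smul, coeff_complex_smul, hf v k hv j hj, smul_zero]

theorem raising_mul_le (r q : ℕ) : M.raising r * M.raising q ≤ M.raising (r + q) :=
  Submodule.mul_le.2 fun f hf g hg v k hv j hj =>
    hf (g v) (k + q) (hg v k hv) j (by omega)

theorem raising_one_pow_le (r : ℕ) : M.raising 1 ^ r ≤ M.raising r := by
  induction r with
  | zero => exact Submodule.one_le.2 fun v k hv j hj => hv j hj
  | succ r ih =>
    exact (pow_succ (M.raising 1) r).le.trans ((mul_le_mul' ih le_rfl).trans (raising_mul_le r 1))

theorem raising_one_mul_le : M.raising 1 * M.raising 1 ≤ M.raising 1 :=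
  (raising_mul_le 1 1).trans fun f hf v k hv j hj => hf v k hv j (by omega)

theorem raising_one_pow_eq_bot : M.raising 1 ^ (N + 1) = ⊥ := by
  refine eq_bot_iff.2 fun f hf => (Submodule.mem_bot ℝ).2 (ContinuousLinearMap.ext fun v => ?_)
  refine M.injective ?_
  ext k
  rcases le_or_gt k N with h | h
  · simpa using raising_one_pow_le (N + 1) hf v 0 (by simp) k (by omega)
  · simpa using M.coeff_eq_zero _ k h

theorem Represents.mem_raising {f : M.Op} {a : 𝒜}
    (hf : M.Represents f (PowerSeries.X * PowerSeries.C a)) : f ∈ M.raising 1 := by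
  intro v k hv j hj
  rcases le_or_gt j N with h | h
  · rw [hf v j h, coeff_X_mul_C_mul]
    split_ifs with h0
    · rfl
    · rw [hv _ (by omega), mul_zero]
  · exact M.coeff_eq_zero _ j h

end TruncatedModel

open TruncatedModel

theorem exists_truncatedModel {ι : Type*} [Fintype ι] (A : ι → 𝒜) (N : ℕ) {η : ℝ} (hη : 0 < η) :
    ∃ (M : TruncatedModel 𝒜 N) (a : ι → M.Op), ∀ i, ‖a i‖ ≤ η ∧
      M.Represents (a i) (PowerSeries.X * PowerSeries.C (A i)) := by
  set S : Submodule ℂ 𝒜 := Submodule.span ℂ (range A)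
  have hS : ∀ k, FiniteDimensional ℂ (S ^ k : Submodule ℂ 𝒜) := fun k =>
    Module.Finite.iff_fg.2 ((Submodule.fg_span (finite_range A)).pow k)
  let T : Submodule ℂ 𝒜⟦X⟧ :=
    { carrier := {F | (∀ k, PowerSeries.coeff k F ∈ S ^ k) ∧
        ∀ k, N < k → PowerSeries.coeff k F = 0}
      add_mem' := fun hF hG => ⟨fun k => by
        rw [map_add]
        exact Submodule.add_mem _ (hF.1 k) (hG.1 k), fun k hk => by
        rw [map_add, hF.2 k hk, hG.2 k hk, add_zero]⟩
      zero_mem' := ⟨fun k => by simp, fun k _ => by simp⟩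
      smul_mem' := fun z F hF => ⟨fun k => Submodule.smul_mem _ z (hF.1 k), fun k hk => by
        rw [coeff_complex_smul, hF.2 k hk, smul_zero]⟩ }
  let κ : T →ₗ[ℂ] ((k : Fin (N + 1)) → (S ^ (k : ℕ) : Submodule ℂ 𝒜)) :=
    { toFun := fun F k => ⟨PowerSeries.coeff k F.1, F.2.1 k⟩
      map_add' := fun F G => rfl
      map_smul' := fun z F => rfl }
  have hκ : Function.Injective κ := fun F G h => by
    refine Subtype.ext (PowerSeries.ext fun k => ?_)
    rcases le_or_gt k N with hk | hk
    · exact congrArg Subtype.val (congrFun h ⟨k, Nat.lt_succ_iff.2 hk⟩)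
    · rw [F.2.2 k hk, G.2.2 k hk]
  have hT : FiniteDimensional ℂ T := FiniteDimensional.of_injective κ hκ
  let e := (Module.finBasis ℂ T).equivFun
  let L : ι → T →ₗ[ℂ] T := fun i =>
    { toFun := fun F => ⟨PowerSeries.mk fun k => if k ≤ N then
          PowerSeries.coeff k (PowerSeries.X * PowerSeries.C (A i) * F.1) else 0, fun k => by
        rw [PowerSeries.coeff_mk, coeff_X_mul_C_mul]
        split_ifs with h1 h2
        · exact Submodule.zero_mem _
        · obtain ⟨k, rfl⟩ := Nat.exists_eq_succ_of_ne_zero h2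
          rw [Nat.succ_eq_add_one, Nat.add_sub_cancel, pow_succ']
          exact Submodule.mul_mem_mul (Submodule.subset_span (mem_range_self i)) (F.2.1 k)
        · exact Submodule.zero_mem _, fun k hk => by
        rw [PowerSeries.coeff_mk, if_neg (not_le.2 hk)]⟩
      map_add' := fun F G => Subtype.ext (PowerSeries.ext fun k => by
        simp only [PowerSeries.coeff_mk, Submodule.coe_add, mul_add, map_add]
        split_ifs <;> simp)
      map_smul' := fun z F => Subtype.ext (PowerSeries.ext fun k => by
        simp only [PowerSeries.coeff_mk, Submodule.coe_smul, mul_smul_comm, coeff_complex_smul,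
          RingHom.id_apply]
        split_ifs <;> simp) }
  let L' : ι → (Fin (Module.finrank ℂ T) → ℂ) →L[ℂ] (Fin (Module.finrank ℂ T) → ℂ) := fun i =>
    LinearMap.toContinuousLinearMap (e.toLinearMap ∘ₗ L i ∘ₗ e.symm.toLinearMap)
  set t : ℝ := η / (1 + ∑ i, ‖L' i‖)
  have hsum : 0 ≤ ∑ i, ‖L' i‖ := Finset.sum_nonneg fun i _ => norm_nonneg _
  have ht : 0 < t := div_pos hη (by linarith)
  have ht0 : (t : ℂ) ≠ 0 := Complex.ofReal_ne_zero.2 ht.ne'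
  let M : TruncatedModel 𝒜 N :=
    { dim := Module.finrank ℂ T
      toSeries :=
        { toFun := fun v => PowerSeries.mk fun k =>
            ((t : ℂ)⁻¹ ^ k) • PowerSeries.coeff k (e.symm v).1
          map_add' := fun v w => PowerSeries.ext fun k => by simp
          map_smul' := fun z v => PowerSeries.ext fun k => by
            rw [map_smul, coeff_complex_smul, PowerSeries.coeff_mk, PowerSeries.coeff_mk]
            exact smul_comm _ _ _ }
      injective := fun v w h => by
        refine e.symm.injective (Subtype.ext (PowerSeries.ext fun k => ?_))
        have := congrArg (PowerSeries.coeff k) h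
        simp only [LinearMap.coe_mk, AddHom.coe_mk, PowerSeries.coeff_mk] at this
        exact smul_right_injective 𝒜 (pow_ne_zero k (inv_ne_zero ht0)) this
      coeff_eq_zero := fun v k hk => by
        simp only [LinearMap.coe_mk, AddHom.coe_mk, PowerSeries.coeff_mk]
        rw [(e.symm v).2.2 k hk, smul_zero]
      unit := e ⟨1, fun k => by
        rw [PowerSeries.coeff_one]
        split_ifs with h
        · rw [h, pow_zero]
          exact Submodule.one_le.1 le_rfl
        · exact Submodule.zero_mem _, fun k hk => by
        rw [PowerSeries.coeff_one, if_neg (by omega)]⟩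
      toSeries_unit := PowerSeries.ext fun k => by
        simp only [LinearMap.coe_mk, AddHom.coe_mk, PowerSeries.coeff_mk,
          LinearEquiv.symm_apply_apply, PowerSeries.coeff_one]
        split_ifs with h <;> simp [h] }
  have hM : ∀ v k, PowerSeries.coeff k (M.toSeries v) =
      ((t : ℂ)⁻¹ ^ k) • PowerSeries.coeff k (e.symm v).1 := fun v k =>
    PowerSeries.coeff_mk k fun k => ((t : ℂ)⁻¹ ^ k) • PowerSeries.coeff k (e.symm v).1
  refine ⟨M, fun i => (t : ℂ) • L' i, fun i => ⟨?_, fun v k hk => ?_⟩⟩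
  · rw [norm_smul, Complex.norm_real, Real.norm_of_nonneg ht.le]
    have h1 : ‖L' i‖ ≤ 1 + ∑ i, ‖L' i‖ := by
      have := Finset.single_le_sum (fun i _ => norm_nonneg (L' i)) (Finset.mem_univ i)
      linarith
    rw [div_mul_eq_mul_div, div_le_iff₀ (by linarith)]
    exact mul_le_mul_of_nonneg_left h1 hη.le
  · have h1 : PowerSeries.coeff k (e.symm (L' i v)).1 =
        PowerSeries.coeff k (PowerSeries.X * PowerSeries.C (A i) * (e.symm v).1) := by
      have h2 : e.symm (L' i v) = L i (e.symm v) := e.symm_apply_apply _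
      rw [h2]
      simp only [L, LinearMap.coe_mk, AddHom.coe_mk, PowerSeries.coeff_mk, if_pos hk]
    have h3 : ((t : ℂ) • L' i) v = (t : ℂ) • L' i v := rfl
    rw [h3, map_smul, coeff_complex_smul, hM, h1, coeff_X_mul_C_mul, coeff_X_mul_C_mul, hM]
    cases k with
    | zero => simp
    | succ k =>
      rw [if_neg (Nat.succ_ne_zero k), if_neg (Nat.succ_ne_zero k), Nat.add_sub_cancel, smul_smul,
        mul_smul_comm, pow_succ', ← mul_assoc, mul_inv_cancel₀ ht0, one_mul]

end TruncatedModels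

section FormalTransport

open TruncatedModel

variable {𝒜 : Type*} [Ring 𝒜] [Algebra ℂ 𝒜]

theorem HasSmoothDeriv.continuousOn_dual {E : Type*} [AddCommGroup E] [Module ℂ E] {a b : ℝ}
    {F F' : ℝ → E} (h : HasSmoothDeriv a b F F') (ψ : Module.Dual ℂ E) :
    ContinuousOn (fun s => ψ (F s)) (Icc a b) := by
  obtain ⟨n, f, v, hf, hF, -⟩ := h
  refine ContinuousOn.congr (f := fun s => ∑ i, f i s • ψ (v i)) ?_ fun s hs => by
    simp [hF s hs]
  exact continuousOn_finsetSum _ fun i _ => (hf i).continuousOn.smul continuousOn_const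

theorem HasSmoothDeriv.hasDerivAt_dual {E : Type*} [AddCommGroup E] [Module ℂ E] {a b : ℝ}
    {F F' : ℝ → E} (h : HasSmoothDeriv a b F F') (ψ : Module.Dual ℂ E) {s : ℝ}
    (hs : s ∈ Ioo a b) : HasDerivAt (fun s => ψ (F s)) (ψ (F' s)) s := by
  obtain ⟨n, f, v, hf, hF, hF'⟩ := h
  have h1 : HasDerivAt (fun s => ∑ i, f i s • ψ (v i)) (∑ i, deriv (f i) s • ψ (v i)) s :=
    HasDerivAt.fun_sum fun i _ => HasDerivAt.smul_const
      ((((hf i).differentiableOn (by simp)) s (Ioo_subset_Icc_self hs)).differentiableAt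
        (Icc_mem_nhds hs.1 hs.2)).hasDerivAt _
  have h2 : ∑ i, deriv (f i) s • ψ (v i) = ψ (F' s) := by simp [hF' s hs]
  rw [← h2]
  refine h1.congr_of_eventuallyEq ?_
  filter_upwards [Icc_mem_nhds hs.1 hs.2] with x hx
  simp [hF x hx]

theorem eq_zero_on_Icc_of_hasDerivAt_zero {a b : ℝ} (hab : a < b) {f : ℝ → ℂ}
    (hf : ContinuousOn f (Icc a b)) (hf' : ∀ s ∈ Ioo a b, HasDerivAt f 0 s) (h0 : f a = 0) :
    ∀ s ∈ Icc a b, f s = 0 := by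
  obtain ⟨x, hx⟩ := isOpen_Ioo.exists_is_const_of_deriv_eq_zero isPreconnected_Ioo
    (fun s hs => (hf' s hs).differentiableAt.differentiableWithinAt)
    (fun s hs => (hf' s hs).deriv)
  have h : EqOn f (fun _ => x) (Icc a b) :=
    EqOn.of_subset_closure hx hf continuousOn_const Ioo_subset_Icc_self
      (closure_Ioo hab.ne).symm.subset
  have hx0 : x = 0 := (h (left_mem_Icc.2 hab.le)).symm.trans h0
  exact fun s hs => (h hs).trans hx0

/-- The coefficient of `dx` in the KZ connection, as an element of the algebra. -/
noncomputable def kzValue (B A : 𝒜) (x : ℝ) : 𝒜 :=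
  ((1 / x : ℝ) : ℂ) • A + ((1 / (x - 1) : ℝ) : ℂ) • B

theorem X_mul_smul_kzConnection (B A : 𝒜) (r x : ℝ) :
    PowerSeries.X * ((r : ℂ) • kzConnection B A x) =
      PowerSeries.X * PowerSeries.C ((r : ℂ) • kzValue B A x) := by
  rw [X_mul_C_smul, mul_smul_comm]
  rfl

theorem affinePath_mem {δ ε : ℝ} (h : (δ, ε) ∈ parameterSet) {s : ℝ} (hs : s ∈ Icc (0 : ℝ) 1) :
    affinePath δ ε s ∈ Ioo (0 : ℝ) 1 := by
  obtain ⟨⟨h1, h2⟩, h3, h4⟩ := h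
  obtain ⟨h5, h6⟩ := hs
  simp only at h1 h2 h3 h4
  rw [affinePath]
  constructor <;> nlinarith

theorem hasDerivAt_affinePath (δ ε s : ℝ) : HasDerivAt (affinePath δ ε) (1 - ε - δ) s := by
  have h := (((hasDerivAt_id s).const_sub 1).mul_const δ).add
    ((hasDerivAt_id s).mul_const (1 - ε))
  exact h.congr_deriv (by ring)

theorem inv_smul_sub_inv_smul {R : Type*} [AddCommGroup R] [Module ℝ R] (x : ℝ) (f g : R) :
    x⁻¹ • f - (1 - x)⁻¹ • g = (1 / x) • f + (1 / (x - 1)) • g := by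
  rw [one_div, one_div, sub_eq_add_neg, ← neg_smul, ← inv_neg, neg_sub]

theorem IsKZSolution.hasDerivAt_comp_affinePath {R : Type*} [NormedRing R] [NormedAlgebra ℝ R]
    {f g : R} {w : ℝ → R} (hw : IsKZSolution f g w) {δ ε : ℝ} (h : (δ, ε) ∈ parameterSet) (z : R)
    {s : ℝ} (hs : s ∈ Icc (0 : ℝ) 1) :
    HasDerivAt (fun s => w (affinePath δ ε s) * z)
      ((1 - ε - δ) • ((affinePath δ ε s)⁻¹ • f - (1 - affinePath δ ε s)⁻¹ • g) *
        (w (affinePath δ ε s) * z)) s := by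
  have h1 := ((hw.hasDerivAt _ (affinePath_mem h hs)).scomp s
    (hasDerivAt_affinePath δ ε s)).mul_const z
  exact h1.congr_deriv (by simp only [smul_mul_assoc, mul_assoc])

variable {N : ℕ} {M : TruncatedModel 𝒜 N}

theorem TruncatedModel.Represents.kzValue {f g : M.Op} {a b : 𝒜}
    (hf : M.Represents f (PowerSeries.X * PowerSeries.C a))
    (hg : M.Represents g (PowerSeries.X * PowerSeries.C b)) (x : ℝ) :
    M.Represents (x⁻¹ • f - (1 - x)⁻¹ • g) (PowerSeries.X * PowerSeries.C (kzValue b a x)) := by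
  rw [inv_smul_sub_inv_smul x f g]
  exact (hf.smul_X _).add_X (hg.smul_X _)

/-- On a truncated model, the formal parallel transport is given by the solutions of the KZ
equation in the Banach algebra of operators. -/
theorem IsKZSolution.represents_transport {f g : M.Op} {a b : 𝒜}
    (hf : M.Represents f (PowerSeries.X * PowerSeries.C a))
    (hg : M.Represents g (PowerSeries.X * PowerSeries.C b)) {w : ℝ → M.Op}
    (hw : IsKZSolution f g w) {δ ε : ℝ} (h : (δ, ε) ∈ parameterSet) {T : 𝒜⟦X⟧}
    (hT : IsParallelTransport (kzConnection b a) (affinePath δ ε) T) :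
    M.Represents (w (1 - ε) * Ring.inverse (w δ)) T := by
  obtain ⟨W, ⟨hW0, hW⟩, rfl⟩ := hT
  set c := affinePath δ ε
  have hc0 : c 0 = δ := by simp [c, affinePath]
  have hc1 : c 1 = 1 - ε := by simp [c, affinePath]
  set κ := 1 - ε - δ
  have hκ : ∀ s, deriv c s = κ := fun s => (hasDerivAt_affinePath δ ε s).deriv
  set V : ℝ → M.Op := fun s => w (c s) * Ring.inverse (w δ)
  set Y : ℝ → M.Op := fun s => κ • ((c s)⁻¹ • f - (1 - c s)⁻¹ • g)
  set y : ℝ → 𝒜 := fun s => (κ : ℂ) • kzValue b a (c s)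
  have hY : ∀ s, M.Represents (Y s) (PowerSeries.X * PowerSeries.C (y s)) := fun s =>
    (hf.kzValue hg _).smul_X κ
  have hV : ∀ s ∈ Icc (0 : ℝ) 1, HasDerivAt V (Y s * V s) s := fun s hs =>
    hw.hasDerivAt_comp_affinePath h _ hs
  have hδ : IsUnit (w δ) := hw.isUnit δ (hc0 ▸ affinePath_mem h (left_mem_Icc.2 zero_le_one))
  have main : ∀ k ≤ N, ∀ v, ∀ s ∈ Icc (0 : ℝ) 1, PowerSeries.coeff k (M.toSeries (V s v)) =
      PowerSeries.coeff k (W s * M.toSeries v) := by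
    intro k
    induction k using Nat.strong_induction_on with
    | _ k ih =>
      intro hk v s hs
      refine eq_of_forall_dual fun ψ => sub_eq_zero.1 ?_
      let ℓ : M.Op →L[ℝ] ℂ := ((M.coord ψ k).comp
        (ContinuousLinearMap.apply ℂ (Fin M.dim → ℂ) v)).restrictScalars ℝ
      have hℓ : ∀ q : M.Op, ℓ q = ψ (PowerSeries.coeff k (M.toSeries (q v))) := fun q => rfl
      let m : ℕ → 𝒜 := fun j => PowerSeries.coeff j (M.toSeries v)
      let ψr : ℕ → Module.Dual ℂ 𝒜 := fun j => ψ ∘ₗ LinearMap.mulRight ℂ (m j)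
      have hsum : ∀ F : 𝒜⟦X⟧, ψ (PowerSeries.coeff k (F * M.toSeries v)) =
          ∑ p ∈ Finset.HasAntidiagonal.antidiagonal k, ψr p.2 (PowerSeries.coeff p.1 F) :=
        fun F => by
        rw [PowerSeries.coeff_mul, map_sum]
        rfl
      have d1 : ∀ s ∈ Icc (0 : ℝ) 1, HasDerivAt (fun s => ℓ (V s)) (ℓ (Y s * V s)) s :=
        fun s hs => ℓ.hasFDerivAt.comp_hasDerivAt s (hV s hs)
      refine eq_zero_on_Icc_of_hasDerivAt_zero zero_lt_one
        (f := fun s => ℓ (V s) - ψ (PowerSeries.coeff k (W s * M.toSeries v))) ?_ ?_ ?_ s hs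
      · refine ContinuousOn.sub (fun s hs => (d1 s hs).continuousAt.continuousWithinAt) ?_
        simp only [hsum]
        exact continuousOn_finsetSum _ fun p _ => (hW p.1).continuousOn_dual _
      · intro s hs
        have hs' := Ioo_subset_Icc_self hs
        have d2 : HasDerivAt (fun s => ψ (PowerSeries.coeff k (W s * M.toSeries v)))
            (ψ (PowerSeries.coeff k (PowerSeries.X * PowerSeries.C (y s) * W s *
              M.toSeries v))) s := by
          simp only [hsum]
          refine HasDerivAt.fun_sum fun p _ => ?_
          have := (hW p.1).hasDerivAt_dual (ψr p.2) hs
          simp only [hκ, X_mul_smul_kzConnection] at this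
          exact this
        refine ((d1 s hs').sub d2).congr_deriv (sub_eq_zero.2 ?_)
        rw [hℓ, mul_apply_eq_comp, hY s (V s v) k hk, coeff_X_mul_C_mul, mul_assoc,
          coeff_X_mul_C_mul]
        split_ifs with hk0
        · rfl
        · rw [ih (k - 1) (by omega) (by omega) v s hs']
      · simp only [hℓ, V, hc0, Ring.mul_inverse_cancel _ hδ, hW0, one_mul,
          one_apply_eq_self, sub_self]
  intro v k hk
  have := main k hk v 1 (right_mem_Icc.2 zero_le_one)
  simpa only [V, hc1] using this

theorem formalExp_neg_mul (a : 𝒜) : formalExp (-a) * formalExp a = 1 := by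
  ext n
  obtain ⟨M, f, hf⟩ := exists_truncatedModel (fun _ : Unit => a) n one_pos
  have h := (hf ()).2
  have h1 := (h.neg_X.exp).mul h.exp
  have h2 : NormedSpace.exp (-f ()) * NormedSpace.exp (f ()) = 1 := by
    simpa [algPow] using algPow_neg_mul (Real.exp 1) (f ())
  rw [h2] at h1
  rw [h1.coeff_eq le_rfl, Represents.one.coeff_eq le_rfl]

theorem exists_smooth_primitive {f : ℝ → ℂ} (hf : ContDiffOn ℝ ∞ f (Ioo 0 1)) {δ : ℝ}
    (hδ : δ ∈ Ioo (0 : ℝ) 1) :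
    ∃ g : ℝ → ℂ, g δ = 0 ∧ ContDiffOn ℝ ∞ g (Ioo 0 1) ∧ ∀ x ∈ Ioo (0 : ℝ) 1, deriv g x = f x := by
  have hd : ∀ x ∈ Ioo (0 : ℝ) 1, HasDerivAt (fun u => ∫ y in δ..u, f y) (f x) x := fun x hx =>
    intervalIntegral.integral_hasDerivAt_right
      ((hf.continuousOn.mono (ordConnected_Ioo.uIcc_subset hδ hx)).intervalIntegrable)
      (hf.continuousOn.stronglyMeasurableAtFilter isOpen_Ioo x hx)
      (hf.continuousOn.continuousAt (isOpen_Ioo.mem_nhds hx))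
  refine ⟨_, intervalIntegral.integral_same, (contDiffOn_infty_iff_deriv_of_isOpen isOpen_Ioo).2
    ⟨fun x hx => (hd x hx).differentiableAt.differentiableWithinAt, ?_⟩,
    fun x hx => (hd x hx).deriv⟩
  exact hf.congr fun x hx => (hd x hx).deriv

/-- `G` is a finite sum of terms `g ⊗ v` with `g` smooth on `]0, 1[`, with derivative `G'`. -/
def HasSmoothDerivOpen (G G' : ℝ → 𝒜) : Prop :=
  ∃ (n : ℕ) (g : Fin n → ℝ → ℂ) (v : Fin n → 𝒜),
    (∀ i, ContDiffOn ℝ ∞ (g i) (Ioo 0 1)) ∧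
    (∀ s ∈ Ioo (0 : ℝ) 1, G s = ∑ i, g i s • v i) ∧
    (∀ s ∈ Ioo (0 : ℝ) 1, G' s = ∑ i, deriv (g i) s • v i)

theorem HasSmoothDerivOpen.exists_kz_primitive {G G' : ℝ → 𝒜} (h : HasSmoothDerivOpen G G')
    (a b : 𝒜) {δ : ℝ} (hδ : δ ∈ Ioo (0 : ℝ) 1) :
    ∃ H : ℝ → 𝒜, H δ = 0 ∧ HasSmoothDerivOpen H fun x => kzValue b a x * G x := by
  obtain ⟨n, g, v, hg, hG, -⟩ := h
  have hofReal : ContDiff ℝ ∞ (fun x : ℝ => (x : ℂ)) := Complex.ofRealCLM.contDiff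
  have h1 : ∀ i, ContDiffOn ℝ ∞ (fun x => ((1 / x : ℝ) : ℂ) * g i x) (Ioo 0 1) := fun i =>
    (hofReal.comp_contDiffOn (contDiffOn_const.div contDiffOn_id fun x hx => hx.1.ne')).mul (hg i)
  have h2 : ∀ i, ContDiffOn ℝ ∞ (fun x => ((1 / (x - 1) : ℝ) : ℂ) * g i x) (Ioo 0 1) := fun i =>
    (hofReal.comp_contDiffOn (contDiffOn_const.div (contDiffOn_id.sub contDiffOn_const)
      fun x hx => (sub_neg.2 hx.2).ne)).mul (hg i)
  choose p hp0 hp hp' using fun i => exists_smooth_primitive (h1 i) hδ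
  choose q hq0 hq hq' using fun i => exists_smooth_primitive (h2 i) hδ
  refine ⟨fun x => ∑ i, p i x • (a * v i) + ∑ i, q i x • (b * v i), by simp [hp0, hq0],
    n + n, Fin.append p q, Fin.append (fun i => a * v i) (fun i => b * v i), ?_, ?_, ?_⟩
  · refine Fin.addCases (fun i => ?_) fun i => ?_
    · rw [Fin.append_left]
      exact hp i
    · rw [Fin.append_right]
      exact hq i
  · intro s _
    simp only [Fin.sum_univ_add, Fin.append_left, Fin.append_right]
  · intro s hs
    simp only [Fin.sum_univ_add, Fin.append_left, Fin.append_right, hp' _ s hs, hq' _ s hs,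
      hG s hs, kzValue, add_mul, Finset.mul_sum, smul_mul_assoc, mul_smul_comm, mul_smul,
      smul_add, Finset.sum_add_distrib]
    exact congrArg₂ _ (Finset.sum_congr rfl fun i _ => smul_comm _ _ _)
      (Finset.sum_congr rfl fun i _ => smul_comm _ _ _)

theorem HasSmoothDerivOpen.comp_affinePath {G G' : ℝ → 𝒜} (h : HasSmoothDerivOpen G G') {δ ε : ℝ}
    (hp : (δ, ε) ∈ parameterSet) :
    HasSmoothDeriv 0 1 (fun s => G (affinePath δ ε s))
      (fun s => ((1 - ε - δ : ℝ) : ℂ) • G' (affinePath δ ε s)) := by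
  obtain ⟨n, g, v, hg, hG, hG'⟩ := h
  refine ⟨n, fun i s => g i (affinePath δ ε s), v, fun i => ?_,
    fun s hs => hG _ (affinePath_mem hp hs), fun s hs => ?_⟩
  · have : ContDiff ℝ ∞ (affinePath δ ε) := by
      unfold affinePath
      fun_prop
    exact (hg i).comp this.contDiffOn fun s hs => affinePath_mem hp hs
  · have hc := affinePath_mem hp (Ioo_subset_Icc_self hs)
    change ((1 - ε - δ : ℝ) : ℂ) • G' _ = _
    rw [hG' _ hc, Finset.smul_sum]
    refine Finset.sum_congr rfl fun i _ => ?_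
    have hd : DifferentiableAt ℝ (g i) (affinePath δ ε s) :=
      ((hg i).differentiableOn (by simp) _ hc).differentiableAt (isOpen_Ioo.mem_nhds hc)
    have := hd.hasDerivAt.scomp s (hasDerivAt_affinePath δ ε s)
    have h2 : deriv (fun s => g i (affinePath δ ε s)) s =
        (1 - ε - δ) • deriv (g i) (affinePath δ ε s) := this.deriv
    rw [h2, smul_smul, Complex.real_smul]

theorem exists_isParallelTransport (a b : 𝒜) {δ ε : ℝ} (hp : (δ, ε) ∈ parameterSet) :
    ∃ T : 𝒜⟦X⟧, IsParallelTransport (kzConnection b a) (affinePath δ ε) T := by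
  have hδ : δ ∈ Ioo (0 : ℝ) 1 := by
    simpa [affinePath] using affinePath_mem hp (left_mem_Icc.2 zero_le_one)
  let S := {G : ℝ → 𝒜 // ∃ G', HasSmoothDerivOpen G G'}
  have one : HasSmoothDerivOpen (fun _ => (1 : 𝒜)) fun _ => 0 :=
    ⟨1, fun _ _ => 1, fun _ => 1, fun _ => contDiffOn_const, fun _ _ => by simp,
      fun _ _ => by simp⟩
  choose H hH0 hH using fun G : S => G.2.choose_spec.exists_kz_primitive a b hδ
  let V : ℕ → S := fun r => Nat.rec ⟨fun _ => 1, _, one⟩ (fun _ G => ⟨H G, _, hH G⟩) r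
  have hV : ∀ r, (V (r + 1)).1 = H (V r) := fun r => rfl
  have hc0 : affinePath δ ε 0 = δ := by simp [affinePath]
  refine ⟨_, fun s => PowerSeries.mk fun r => (V r).1 (affinePath δ ε s), ⟨?_, fun r => ?_⟩, rfl⟩
  · ext r
    rw [PowerSeries.coeff_mk, hc0, PowerSeries.coeff_one]
    cases r with
    | zero => rfl
    | succ r => rw [hV, hH0, if_neg (Nat.succ_ne_zero r)]
  · simp only [(hasDerivAt_affinePath δ ε _).deriv, X_mul_smul_kzConnection, coeff_X_mul_C_mul,
      PowerSeries.coeff_mk]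
    cases r with
    | zero =>
      have h0 : (V 0).1 = fun _ => 1 := rfl
      simpa [h0] using one.comp_affinePath hp
    | succ r => simpa [hV, smul_mul_assoc] using (hH (V r)).comp_affinePath hp

end FormalTransport

section Associator

open TruncatedModel

theorem exists_definite_seminorm (E : Type*) [AddCommGroup E] [Module ℂ E] :
    ∃ N : Seminorm ℂ E, ∀ x, N x = 0 → x = 0 := by
  let b := Module.Basis.ofVectorSpace ℂ E
  have hs : ∀ x, Summable fun i => ‖b.repr x i‖ := fun x =>
    summable_of_hasFiniteSupport ((b.repr x).hasFiniteSupport.subset fun i hi => by simpa using hi)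
  refine ⟨Seminorm.of (fun x => ∑' i, ‖b.repr x i‖) (fun x y => ?_) (fun z x => ?_),
    fun x hx => ?_⟩
  · rw [← (hs x).tsum_add (hs y)]
    refine (hs _).tsum_le_tsum (fun i => ?_) ((hs x).add (hs y))
    simpa using norm_add_le (b.repr x i) (b.repr y i)
  · rw [← tsum_mul_left]
    simp
  · have h : HasSum (fun i => ‖b.repr x i‖) 0 := by
      have := (hs x).hasSum
      rwa [show ∑' i, ‖b.repr x i‖ = 0 from hx] at this
    have h0 := (hasSum_zero_iff_of_nonneg fun i => norm_nonneg (b.repr x i)).1 h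
    exact b.repr.map_eq_zero_iff.1 (Finsupp.ext fun i => norm_eq_zero.1 (congrFun h0 i))

theorem Seminorm.tendsto_zero_of_tendsto {E ι : Type*} [AddCommGroup E] [Module ℂ E]
    (N : Seminorm ℂ E) {d : ℕ} (L : (Fin d → ℂ) →ₗ[ℂ] E) {l : Filter ι} {v : ι → Fin d → ℂ}
    {v₀ : Fin d → ℂ} (hv : Tendsto v l (𝓝 v₀)) :
    Tendsto (fun i => N (L (v i) - L v₀)) l (𝓝 0) := by
  have h1 : Tendsto (fun i => ∑ j, ‖v i j - v₀ j‖ * N (L (Pi.single j 1))) l (𝓝 0) := by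
    rw [← Finset.sum_const_zero (s := (Finset.univ : Finset (Fin d)))]
    refine tendsto_finsetSum _ fun j _ => ?_
    have := (tendsto_iff_norm_sub_tendsto_zero.1 ((continuous_apply j).tendsto _ |>.comp hv))
    simpa using this.mul_const (N (L (Pi.single j 1)))
  refine squeeze_zero (fun i => apply_nonneg N _) (fun i => ?_) h1
  have h2 : L (v i) - L v₀ = ∑ j, (v i j - v₀ j) • L (Pi.single j 1) := by
    rw [← map_sub, L.pi_apply_eq_sum_univ]
    simp only [Pi.sub_apply]
    refine Finset.sum_congr rfl fun j _ => congrArg _ (congrArg L (funext fun k => ?_))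
    simp [Pi.single_apply, eq_comm]
  rw [h2]
  refine (Finset.le_sum_of_subadditive N (map_zero N).le (map_add_le_add N) _ _).trans
    (Finset.sum_le_sum fun j _ => ?_)
  rw [map_smul_eq_mul]

variable {𝒜 : Type*} [Ring 𝒜] [Algebra ℂ 𝒜]

theorem HasFormalLimit.tendsto_dual {P : Type*} [TopologicalSpace P] {J : Set P} {p₀ : P}
    {F : P → 𝒜⟦X⟧} {ξ : 𝒜⟦X⟧} (h : HasFormalLimit J p₀ F ξ) (r : ℕ) (ψ : Module.Dual ℂ 𝒜) :
    Tendsto (fun p => ψ (PowerSeries.coeff r (F p))) (𝓝[J] p₀) (𝓝 (ψ (PowerSeries.coeff r ξ))) := by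
  obtain ⟨N, hN⟩ := exists_definite_seminorm 𝒜
  have hval : ∀ x, (N + (normSeminorm ℂ ℂ).comp ψ) x = N x + ‖ψ x‖ := fun x => rfl
  have h1 := (h r).2 (N + (normSeminorm ℂ ℂ).comp ψ) fun x hx => hN x <| by
    rw [hval] at hx
    linarith [apply_nonneg N x, norm_nonneg (ψ x)]
  refine tendsto_iff_norm_sub_tendsto_zero.2
    (squeeze_zero (fun _ => norm_nonneg _) (fun p => ?_) h1)
  rw [hval, ← map_sub]
  exact le_add_of_nonneg_left (apply_nonneg N _)

theorem nhdsWithin_parameterSet :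
    𝓝[parameterSet] ((0 : ℝ), (0 : ℝ)) = 𝓝[>] (0 : ℝ) ×ˢ 𝓝[>] (0 : ℝ) := by
  rw [parameterSet, nhdsWithin_prod_eq, nhdsWithin_Ioc_eq_nhdsGT (by norm_num)]

theorem IsConnectionElement.exists_tendsto_transport {R : Type*} [NormedRing R]
    [NormedAlgebra ℝ R] [CompleteSpace R] {A B φ : R} (h : IsConnectionElement A B φ) :
    ∃ w, IsKZSolution A B w ∧ Tendsto (fun p : ℝ × ℝ =>
      algPow p.2 (-B) * (w (1 - p.2) * Ring.inverse (w p.1)) * algPow p.1 A)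
      (𝓝[parameterSet] (0, 0)) (𝓝 φ) := by
  obtain ⟨w, hw, h0, h1⟩ := h.exists_solution
  refine ⟨w, hw, ?_⟩
  have h2 := (h1.comp tendsto_snd).mul ((isUnit_one.tendsto_ringInverse h0).comp
    (tendsto_fst (f := 𝓝[>] (0 : ℝ)) (g := 𝓝[>] (0 : ℝ))))
  rw [Ring.inverse_one, mul_one, ← nhdsWithin_parameterSet] at h2
  refine h2.congr' ?_
  filter_upwards [self_mem_nhdsWithin] with p hp
  have hp1 : p.1 ∈ Ioo (0 : ℝ) 1 := ⟨hp.1.1, hp.1.2.trans_lt (by norm_num)⟩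
  simp only [Function.comp_apply]
  rw [ringInverse_mul_of_isUnit (isUnit_algPow _ _) (hw.isUnit _ hp1), ringInverse_algPow, neg_neg]
  simp only [mul_assoc]

variable {N : ℕ} {M : TruncatedModel 𝒜 N}

theorem IsKZSolution.represents_regularized {f g : M.Op} {a b : 𝒜}
    (hf : M.Represents f (PowerSeries.X * PowerSeries.C a))
    (hg : M.Represents g (PowerSeries.X * PowerSeries.C b)) {w : ℝ → M.Op}
    (hw : IsKZSolution f g w) {δ ε : ℝ} (h : (δ, ε) ∈ parameterSet) {T : 𝒜⟦X⟧}
    (hT : IsParallelTransport (kzConnection b a) (affinePath δ ε) T) :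
    M.Represents (algPow ε (-g) * (w (1 - ε) * Ring.inverse (w δ)) * algPow δ f)
      (formalExp (-(((Real.log ε : ℝ) : ℂ) • b)) * T *
        formalExp (((Real.log δ : ℝ) : ℂ) • a)) := by
  have h1 := hg.neg_X.algPow ε
  rw [smul_neg] at h1
  exact (h1.mul (hw.represents_transport hf hg h hT)).mul (hf.algPow δ)

theorem formalExp_mul_neg (a : 𝒜) : formalExp a * formalExp (-a) = 1 := by
  simpa using formalExp_neg_mul (-a)

/-- The associator is represented by the connection element of the operators. -/
theorem IsConnectionElement.represents {f g φ : M.Op} {a b : 𝒜} {Φ : 𝒜⟦X⟧}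
    (hφ : IsConnectionElement f g φ) (hΦ : IsDrinfeldAssociator a b Φ)
    (hf : M.Represents f (PowerSeries.X * PowerSeries.C a))
    (hg : M.Represents g (PowerSeries.X * PowerSeries.C b)) : M.Represents φ Φ := by
  obtain ⟨W, Φr, hW, hlim⟩ := hΦ
  obtain ⟨w, hw, hφw⟩ := hφ.exists_tendsto_transport
  intro v k hk
  refine eq_of_forall_dual fun ψ => ?_
  let ψr : ℕ → Module.Dual ℂ 𝒜 := fun j =>
    ψ ∘ₗ LinearMap.mulRight ℂ (PowerSeries.coeff j (M.toSeries v))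
  have hsum : ∀ F : 𝒜⟦X⟧, ψ (PowerSeries.coeff k (F * M.toSeries v)) =
      ∑ p ∈ Finset.HasAntidiagonal.antidiagonal k, ψr p.2 (PowerSeries.coeff p.1 F) := fun F => by
    rw [PowerSeries.coeff_mul, map_sum]
    rfl
  have h1 : Tendsto (fun p => ψ (PowerSeries.coeff k (Φr p * M.toSeries v)))
      (𝓝[parameterSet] (0, 0)) (𝓝 (ψ (PowerSeries.coeff k (Φ * M.toSeries v)))) := by
    simp only [hsum]
    exact tendsto_finsetSum _ fun p _ => hlim.tendsto_dual p.1 (ψr p.2)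
  have h2 := (((M.coord ψ k).comp
    (ContinuousLinearMap.apply ℂ (Fin M.dim → ℂ) v)).continuous.tendsto φ).comp hφw
  have : (𝓝[parameterSet] ((0 : ℝ), (0 : ℝ))).NeBot := by
    rw [nhdsWithin_parameterSet]
    infer_instance
  refine tendsto_nhds_unique (h2.congr' ?_) h1
  filter_upwards [self_mem_nhdsWithin] with p hp
  obtain ⟨hT, hfac⟩ := hW p.1 p.2 hp
  have h3 := hw.represents_regularized hf hg hp hT
  have h4 : formalExp (-(((Real.log p.2 : ℝ) : ℂ) • b)) * W p *
      formalExp (((Real.log p.1 : ℝ) : ℂ) • a) = Φr p := by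
    rw [hfac, mul_assoc, mul_assoc, formalExp_neg_mul, mul_one, ← mul_assoc, formalExp_neg_mul,
      one_mul]
  rw [h4] at h3
  exact congrArg ψ (h3 v k hk)

theorem TruncatedModel.Represents.exists_isConnectionElement {f g : M.Op} {a b : 𝒜}
    (hf : M.Represents f (PowerSeries.X * PowerSeries.C a))
    (hg : M.Represents g (PowerSeries.X * PowerSeries.C b)) (hf1 : ‖f‖ ≤ 1 / 16)
    (hg1 : ‖g‖ ≤ 1 / 16) : ∃ φ, IsConnectionElement f g φ :=
  _root_.exists_isConnectionElement raising_one_mul_le raising_one_pow_eq_bot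
    hf.mem_raising hg.mem_raising hf1 hg1

theorem exists_model_connectionElement (a b : 𝒜) (N : ℕ) :
    ∃ (M : TruncatedModel 𝒜 N) (f g φ : M.Op),
      M.Represents f (PowerSeries.X * PowerSeries.C a) ∧
      M.Represents g (PowerSeries.X * PowerSeries.C b) ∧ IsConnectionElement f g φ := by
  obtain ⟨M, x, hx⟩ := exists_truncatedModel ![a, b] N (by norm_num : (0 : ℝ) < 1 / 16)
  obtain ⟨φ, hφ⟩ := (hx 0).2.exists_isConnectionElement (hx 1).2 (hx 0).1 (hx 1).1
  exact ⟨M, x 0, x 1, φ, (hx 0).2, (hx 1).2, hφ⟩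

theorem IsDrinfeldAssociator.unique {a b : 𝒜} {Φ Ψ : 𝒜⟦X⟧} (hΦ : IsDrinfeldAssociator a b Φ)
    (hΨ : IsDrinfeldAssociator a b Ψ) : Φ = Ψ := by
  ext k
  obtain ⟨M, f, g, φ, hf, hg, hφ⟩ := exists_model_connectionElement a b k
  rw [(hφ.represents hΦ hf hg).coeff_eq le_rfl, (hφ.represents hΨ hf hg).coeff_eq le_rfl]

variable (M) in
/-- The coefficient of degree `k`, as a linear map on a truncated model. -/
noncomputable def TruncatedModel.coeffHom (k : ℕ) : (Fin M.dim → ℂ) →ₗ[ℂ] 𝒜 where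
  toFun v := PowerSeries.coeff k (M.toSeries v)
  map_add' v w := by simp
  map_smul' z v := by rw [map_smul, coeff_complex_smul, RingHom.id_apply]

theorem TruncatedModel.Represents.hasFormalLimit_coeff {P : Type*} [TopologicalSpace P] {J : Set P}
    {p₀ : P} {F : P → 𝒜⟦X⟧} {f : P → M.Op} {f₀ : M.Op} (hF : ∀ p ∈ J, M.Represents (f p) (F p))
    (hf : Tendsto f (𝓝[J] p₀) (𝓝 f₀)) {k : ℕ} (hk : k ≤ N) :
    (∃ V : Submodule ℂ 𝒜, FiniteDimensional ℂ V ∧ ∀ p ∈ J, PowerSeries.coeff k (F p) ∈ V) ∧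
    ∀ S : Seminorm ℂ 𝒜, (∀ x, S x = 0 → x = 0) →
      Tendsto (fun p => S (PowerSeries.coeff k (F p) - M.coeffHom k (f₀ M.unit)))
        (𝓝[J] p₀) (𝓝 0) := by
  have key : ∀ p ∈ J, PowerSeries.coeff k (F p) = M.coeffHom k (f p M.unit) := fun p hp =>
    (hF p hp).coeff_eq hk
  refine ⟨⟨LinearMap.range (M.coeffHom k), inferInstance, fun p hp => ?_⟩, fun S _ => ?_⟩
  · rw [key p hp]
    exact LinearMap.mem_range_self _ _
  · have h1 := ((ContinuousLinearMap.apply ℂ (Fin M.dim → ℂ) M.unit).continuous.tendsto f₀).comp hf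
    refine (S.tendsto_zero_of_tendsto (M.coeffHom k) h1).congr' ?_
    filter_upwards [self_mem_nhdsWithin] with p hp
    rw [key p hp]
    rfl

theorem exists_coeff_limit (a b : 𝒜) {T : ℝ × ℝ → 𝒜⟦X⟧} (hT : ∀ p ∈ parameterSet,
      IsParallelTransport (kzConnection b a) (affinePath p.1 p.2) (T p)) (r : ℕ) :
    ∃ x : 𝒜, (∃ V : Submodule ℂ 𝒜, FiniteDimensional ℂ V ∧ ∀ p ∈ parameterSet,
      PowerSeries.coeff r (formalExp (-(((Real.log p.2 : ℝ) : ℂ) • b)) * T p *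
        formalExp (((Real.log p.1 : ℝ) : ℂ) • a)) ∈ V) ∧
    ∀ S : Seminorm ℂ 𝒜, (∀ x, S x = 0 → x = 0) →
      Tendsto (fun p => S (PowerSeries.coeff r (formalExp (-(((Real.log p.2 : ℝ) : ℂ) • b)) * T p *
        formalExp (((Real.log p.1 : ℝ) : ℂ) • a)) - x)) (𝓝[parameterSet] (0, 0)) (𝓝 0) := by
  obtain ⟨M, f, g, φ, hf, hg, hφ⟩ := exists_model_connectionElement a b r
  obtain ⟨w, hw, hφw⟩ := hφ.exists_tendsto_transport
  exact ⟨_, Represents.hasFormalLimit_coeff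
    (fun p hp => hw.represents_regularized hf hg hp (hT p hp)) hφw le_rfl⟩

theorem exists_isDrinfeldAssociator (a b : 𝒜) : ∃ Φ, IsDrinfeldAssociator a b Φ := by
  choose! T hT using fun (p : ℝ × ℝ) (hp : p ∈ parameterSet) => exists_isParallelTransport a b hp
  choose x hx using exists_coeff_limit a b hT
  refine ⟨PowerSeries.mk x, T, fun p =>
    formalExp (-(((Real.log p.2 : ℝ) : ℂ) • b)) * T p * formalExp (((Real.log p.1 : ℝ) : ℂ) • a),
    fun δ ε h => ⟨hT (δ, ε) h, ?_⟩, fun r => ?_⟩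
  · simp only [mul_assoc, formalExp_mul_neg, mul_one]
    rw [← mul_assoc, formalExp_mul_neg, one_mul]
  · rw [PowerSeries.coeff_mk]
    exact hx r

theorem isDrinfeldAssociator_drinfeldAssociator (a b : 𝒜) :
    IsDrinfeldAssociator a b (drinfeldAssociator a b) := by
  have h := exists_isDrinfeldAssociator a b
  rw [drinfeldAssociator, dif_pos h]
  exact h.choose_spec

end Associator

section Pentagon

open TruncatedModel

theorem InfinitesimalBraidRelations.comm_three' {R : Type*} [Ring R] {n : ℕ}
    {A : Fin n → Fin n → R} (hA : InfinitesimalBraidRelations A) {i j k : Fin n} (hij : i ≠ j)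
    (hik : i ≠ k) (hjk : j ≠ k) : Commute (A i k + A j k) (A i j) := by
  rw [hA.symm i k hik, hA.symm j k hjk]
  exact hA.comm_three k i j hik.symm hjk.symm hij

theorem InfinitesimalBraidRelations.isPentagonal {R : Type*} [Ring R] {A : Fin 4 → Fin 4 → R}
    (hA : InfinitesimalBraidRelations A) :
    IsPentagonal ![A 0 1, A 0 1 + A 0 2 + A 1 2, A 1 2, A 1 2 + A 1 3 + A 2 3, A 2 3] := by
  have h1 : Commute (A 0 2 + A 1 2) (A 0 1) :=
    hA.comm_three' (i := 0) (j := 1) (k := 2) (by decide) (by decide) (by decide)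
  have h2 : Commute (A 0 1 + A 0 2) (A 1 2) :=
    hA.comm_three 0 1 2 (by decide) (by decide) (by decide)
  have h3 : Commute (A 1 3 + A 2 3) (A 1 2) :=
    hA.comm_three' (i := 1) (j := 2) (k := 3) (by decide) (by decide) (by decide)
  have h4 : Commute (A 1 2 + A 1 3) (A 2 3) :=
    hA.comm_three 1 2 3 (by decide) (by decide) (by decide)
  have h5 : Commute (A 2 3) (A 0 1) :=
    hA.comm_four 2 3 0 1 (by decide) (by decide) (by decide) (by decide) (by decide) (by decide)
  have h6 : Commute (A 0 2) (A 1 3) :=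
    hA.comm_four 0 2 1 3 (by decide) (by decide) (by decide) (by decide) (by decide) (by decide)
  refine ⟨fun i => ?_, ?_⟩
  · fin_cases i
    · have := (Commute.refl (A 0 1)).add_right h1.symm
      rwa [← add_assoc] at this
    · exact h2.add_left (Commute.refl _)
    · have := (Commute.refl (A 1 2)).add_right h3.symm
      rwa [← add_assoc] at this
    · exact h4.add_left (Commute.refl _)
    · exact h5
  · have e2 := sub_eq_zero.2 h2.eq
    have e3 := sub_eq_zero.2 h3.eq
    have e5 := sub_eq_zero.2 h5.eq
    have e6 := sub_eq_zero.2 h6.eq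
    have e : ∑ i, (![A 0 1, A 0 1 + A 0 2 + A 1 2, A 1 2, A 1 2 + A 1 3 + A 2 3, A 2 3] i *
        ![A 0 1, A 0 1 + A 0 2 + A 1 2, A 1 2, A 1 2 + A 1 3 + A 2 3, A 2 3] (i + 2) -
        ![A 0 1, A 0 1 + A 0 2 + A 1 2, A 1 2, A 1 2 + A 1 3 + A 2 3, A 2 3] (i + 2) *
        ![A 0 1, A 0 1 + A 0 2 + A 1 2, A 1 2, A 1 2 + A 1 3 + A 2 3, A 2 3] i) =
        ((A 0 1 + A 0 2) * A 1 2 - A 1 2 * (A 0 1 + A 0 2)) -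
        ((A 1 3 + A 2 3) * A 1 2 - A 1 2 * (A 1 3 + A 2 3)) +
        (A 2 3 * A 0 1 - A 0 1 * A 2 3) + (A 0 2 * A 1 3 - A 1 3 * A 0 2) := by
      rw [Fin.sum_univ_five]
      change (A 0 1 * A 1 2 - A 1 2 * A 0 1) +
        ((A 0 1 + A 0 2 + A 1 2) * (A 1 2 + A 1 3 + A 2 3) -
          (A 1 2 + A 1 3 + A 2 3) * (A 0 1 + A 0 2 + A 1 2)) +
        (A 1 2 * A 2 3 - A 2 3 * A 1 2) +
        ((A 1 2 + A 1 3 + A 2 3) * A 0 1 - A 0 1 * (A 1 2 + A 1 3 + A 2 3)) +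
        (A 2 3 * (A 0 1 + A 0 2 + A 1 2) - (A 0 1 + A 0 2 + A 1 2) * A 2 3) = _
      noncomm_ring
    rw [e, e2, e3, e5, e6]
    simp

theorem InfinitesimalBraidRelations.pentagon {R : Type*} [NormedRing R] [NormedAlgebra ℝ R]
    [FiniteDimensional ℝ R] [CompleteSpace R] {A : Fin 4 → Fin 4 → R}
    (hA : InfinitesimalBraidRelations A) {J : Submodule ℝ R} (hJ : J * J ≤ J) {n : ℕ}
    (hn : J ^ n = ⊥) (hAJ : ∀ i j, A i j ∈ J) (hsm : ∀ i j, ‖A i j‖ ≤ 1 / 48)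
    {φ₁ φ₂ φ₃ φ₄ φ₅ : R} (h₁ : IsConnectionElement (A 0 1) (A 1 2 + A 1 3) φ₁)
    (h₂ : IsConnectionElement (A 0 2 + A 1 2) (A 2 3) φ₂)
    (h₃ : IsConnectionElement (A 1 2) (A 2 3) φ₃)
    (h₄ : IsConnectionElement (A 0 1 + A 0 2) (A 1 3 + A 2 3) φ₄)
    (h₅ : IsConnectionElement (A 0 1) (A 1 2) φ₅) : φ₁ * φ₂ = φ₃ * φ₄ * φ₅ := by
  have hc := hA.isPentagonal
  have h1 : Commute (A 0 2 + A 1 2) (A 0 1) :=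
    hA.comm_three' (i := 0) (j := 1) (k := 2) (by decide) (by decide) (by decide)
  have h2 : Commute (A 0 1 + A 0 2) (A 1 2) :=
    hA.comm_three 0 1 2 (by decide) (by decide) (by decide)
  have h3 : Commute (A 1 3 + A 2 3) (A 1 2) :=
    hA.comm_three' (i := 1) (j := 2) (k := 3) (by decide) (by decide) (by decide)
  have h4 : Commute (A 1 2 + A 1 3) (A 2 3) :=
    hA.comm_three 1 2 3 (by decide) (by decide) (by decide)
  have h5 : Commute (A 2 3) (A 0 1) :=
    hA.comm_four 2 3 0 1 (by decide) (by decide) (by decide) (by decide) (by decide) (by decide)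
  obtain ⟨W, hW⟩ := exists_isFlatSection hc hJ hn fun i => by
    fin_cases i
    exacts [hAJ _ _, J.add_mem (J.add_mem (hAJ _ _) (hAJ _ _)) (hAJ _ _), hAJ _ _,
      J.add_mem (J.add_mem (hAJ _ _) (hAJ _ _)) (hAJ _ _), hAJ _ _]
  have hle : ∀ i j, ‖A i j‖ ≤ 1 / 16 := fun i j => (hsm i j).trans (by norm_num)
  have hle3 : ∀ i j k l p q, ‖A i j + A k l + A p q‖ ≤ 1 / 16 := fun i j k l p q =>
    norm_add₃_le.trans (by linarith [hsm i j, hsm k l, hsm p q])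
  obtain ⟨u₁, rfl⟩ := h₁.isUnit
  obtain ⟨u₂, rfl⟩ := h₂.isUnit
  have k₁ := (h₁.add (C := 0) (D := A 2 3) (Commute.zero_right _) (Commute.zero_right _) h5.symm h4
    (Commute.zero_left _)).symm u₁.inv_mul u₁.mul_inv
  have k₂ := (h₂.add (C := A 0 1) (D := 0) h1 h5 (Commute.zero_right _) (Commute.zero_right _)
    (Commute.zero_right _)).symm u₂.inv_mul u₂.mul_inv
  have k₄ := h₄.add (C := A 1 2) (D := A 1 2) h2 h3 h2 h3 (Commute.refl _)
  have key := hW.pentagon (φ := ![φ₅, φ₄, φ₃, (u₁⁻¹ : Rˣ), (u₂⁻¹ : Rˣ)]) hc (fun i => by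
      fin_cases i
      exacts [hle _ _, hle3 _ _ _ _ _ _, hle _ _, hle3 _ _ _ _ _ _, hle _ _]) fun i => by
    fin_cases i
    · exact h₅
    · have : A 1 2 + A 1 3 + A 2 3 = A 1 3 + A 2 3 + A 1 2 := by abel
      change IsConnectionElement (A 0 1 + A 0 2 + A 1 2) (A 1 2 + A 1 3 + A 2 3) φ₄
      rwa [this]
    · exact h₃
    · rwa [add_zero] at k₁
    · have : A 0 2 + A 1 2 + A 0 1 = A 0 1 + A 0 2 + A 1 2 := by abel
      rwa [add_zero, this] at k₂
  have key' : (u₂⁻¹ : Rˣ) * (u₁⁻¹ : Rˣ) * φ₃ * φ₄ * φ₅ = 1 := key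
  have h6 : (u₁ : R) * u₂ * ((u₂⁻¹ : Rˣ) * (u₁⁻¹ : Rˣ) * φ₃ * φ₄ * φ₅) = φ₃ * φ₄ * φ₅ := by
    simp only [mul_assoc, Units.mul_inv_cancel_left]
  rw [← h6, key', mul_one]

theorem TruncatedModel.Represents.ext {𝒜 : Type*} [Ring 𝒜] [Algebra ℂ 𝒜] {N : ℕ}
    {M : TruncatedModel 𝒜 N} {f g : M.Op} {F : 𝒜⟦X⟧} (hf : M.Represents f F)
    (hg : M.Represents g F) : f = g := by
  refine ContinuousLinearMap.ext fun v => M.injective (PowerSeries.ext fun k => ?_)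
  rcases le_or_gt k N with hk | hk
  · rw [hf v k hk, hg v k hk]
  · rw [M.coeff_eq_zero _ k hk, M.coeff_eq_zero _ k hk]

theorem TruncatedModel.Represents.commute {𝒜 : Type*} [Ring 𝒜] [Algebra ℂ 𝒜] {N : ℕ}
    {M : TruncatedModel 𝒜 N} {f g : M.Op} {a b : 𝒜}
    (hf : M.Represents f (PowerSeries.X * PowerSeries.C a))
    (hg : M.Represents g (PowerSeries.X * PowerSeries.C b)) (h : Commute a b) : Commute f g := by
  have hX : ∀ F : 𝒜⟦X⟧, Commute PowerSeries.X F := fun F => (PowerSeries.commute_X F).symm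
  have h1 : Commute (PowerSeries.X * PowerSeries.C a : 𝒜⟦X⟧)
      (PowerSeries.X * PowerSeries.C b) :=
    (hX _).mul_left ((hX _).symm.mul_right (h.map PowerSeries.C))
  have h2 := hg.mul hf
  rw [← h1.eq] at h2
  exact (hf.mul hg).ext h2

theorem InfinitesimalBraidRelations.of_represents {𝒜 : Type*} [Ring 𝒜] [Algebra ℂ 𝒜] {N n : ℕ}
    {M : TruncatedModel 𝒜 N} {A : Fin n → Fin n → 𝒜} (hA : InfinitesimalBraidRelations A)
    {f : Fin n → Fin n → M.Op}
    (hf : ∀ i j, M.Represents (f i j) (PowerSeries.X * PowerSeries.C (A i j))) :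
    InfinitesimalBraidRelations f where
  symm i j hij := (hf i j).ext (hA.symm i j hij ▸ hf j i)
  comm_three i j k hij hik hjk :=
    ((hf i j).add_X (hf i k)).commute (hf j k) (hA.comm_three i j k hij hik hjk)
  comm_four i j k l h1 h2 h3 h4 h5 h6 :=
    (hf i j).commute (hf k l) (hA.comm_four i j k l h1 h2 h3 h4 h5 h6)

end Pentagon

/-- The letters `1, 2, 3, 4` are the elements `0, 1, 2, 3` of `Fin 4`. -/
theorem mainTheorem1 {𝒜 : Type*} [Ring 𝒜] [Algebra ℂ 𝒜] (A : Fin 4 → Fin 4 → 𝒜)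
    (hA : InfinitesimalBraidRelations A) :
    (∀ a b : 𝒜, ∃! Φ : PowerSeries 𝒜, IsDrinfeldAssociator a b Φ) ∧
    drinfeldAssociator (A 0 1) (A 1 2 + A 1 3) * drinfeldAssociator (A 0 2 + A 1 2) (A 2 3) =
      drinfeldAssociator (A 1 2) (A 2 3) *
        drinfeldAssociator (A 0 1 + A 0 2) (A 1 3 + A 2 3) *
          drinfeldAssociator (A 0 1) (A 1 2) := by
  refine ⟨fun a b => ?_, ?_⟩
  · obtain ⟨Φ, hΦ⟩ := exists_isDrinfeldAssociator a b
    exact ⟨Φ, hΦ, fun Ψ hΨ => hΨ.unique hΦ⟩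
  · ext k
    obtain ⟨M, x, hx⟩ := exists_truncatedModel (fun p : Fin 4 × Fin 4 => A p.1 p.2) k
      (by norm_num : (0 : ℝ) < 1 / 48)
    let f : Fin 4 → Fin 4 → M.Op := fun i j => x (i, j)
    have hf : ∀ i j, M.Represents (f i j) (PowerSeries.X * PowerSeries.C (A i j)) :=
      fun i j => (hx (i, j)).2
    have hsm : ∀ i j, ‖f i j‖ ≤ 1 / 48 := fun i j => (hx (i, j)).1
    have hsm1 : ∀ i j, ‖f i j‖ ≤ 1 / 16 := fun i j => (hsm i j).trans (by norm_num)
    have hsm2 : ∀ i j i' j', ‖f i j + f i' j'‖ ≤ 1 / 16 := fun i j i' j' =>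
      (norm_add_le _ _).trans (by linarith [hsm i j, hsm i' j'])
    have exists_connection : ∀ {g h : M.Op} {a b : 𝒜},
        M.Represents g (PowerSeries.X * PowerSeries.C a) →
        M.Represents h (PowerSeries.X * PowerSeries.C b) → ‖g‖ ≤ 1 / 16 → ‖h‖ ≤ 1 / 16 →
        ∃ φ, IsConnectionElement g h φ ∧ M.Represents φ (drinfeldAssociator a b) := by
      intro g h a b hg hh hg1 hh1
      obtain ⟨φ, hφ⟩ := hg.exists_isConnectionElement hh hg1 hh1
      exact ⟨φ, hφ, hφ.represents (isDrinfeldAssociator_drinfeldAssociator a b) hg hh⟩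
    obtain ⟨φ₁, h₁, r₁⟩ := exists_connection (hf 0 1) ((hf 1 2).add_X (hf 1 3)) (hsm1 _ _)
      (hsm2 _ _ _ _)
    obtain ⟨φ₂, h₂, r₂⟩ := exists_connection ((hf 0 2).add_X (hf 1 2)) (hf 2 3) (hsm2 _ _ _ _)
      (hsm1 _ _)
    obtain ⟨φ₃, h₃, r₃⟩ := exists_connection (hf 1 2) (hf 2 3) (hsm1 _ _) (hsm1 _ _)
    obtain ⟨φ₄, h₄, r₄⟩ := exists_connection ((hf 0 1).add_X (hf 0 2))
      ((hf 1 3).add_X (hf 2 3)) (hsm2 _ _ _ _) (hsm2 _ _ _ _)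
    obtain ⟨φ₅, h₅, r₅⟩ := exists_connection (hf 0 1) (hf 1 2) (hsm1 _ _) (hsm1 _ _)
    have key := (hA.of_represents hf).pentagon TruncatedModel.raising_one_mul_le
      TruncatedModel.raising_one_pow_eq_bot (fun i j => (hf i j).mem_raising) hsm h₁ h₂ h₃ h₄ h₅
    rw [(r₁.mul r₂).coeff_eq le_rfl, ((r₃.mul r₄).mul r₅).coeff_eq le_rfl, key]
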